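/- Let $q$ be a prime power and let $n\ge 1$, $t\ge 1$ be integers with $q^t>2$. Let $H_\infty\cong\mathrm{PG}(n,q^t)$ be a hyperplane of the projective space $\mathrm{PG}(n+1,q^t)$, and let $\mathcal S\cong\mathrm{PG}(n,q)$ be an $n$-dimensional subgeometry of $H_\infty$ of order $q$, that is, the set of all points of $H_\infty$ that have homogeneous coordinates in the subfield $\mathbb F_q$ of $\mathbb F_{q^t}$ with respect to some fixed frame of $H_\infty$. Let $T_n^*(\mathcal S)$ be the linear representation of $\mathcal S$: the point-line incidence structure whose points are the points of $\mathrm{PG}(n+1,q^t)$ not in $H_\infty$, whose lines are the lines of $\mathrm{PG}(n+1,q^t)$ meeting $H_\infty$ in exactly one point, this point belonging to $\mathcal S$, and whose incidence is the natural one. Let $\mathrm{Aut}(T_n^*(\mathcal S))$ be its full automorphism group, and let the geometric automorphism group $G$ be the subgroup of those automorphisms of $T_n^*(\mathcal S)$ that are induced by collineations (elements of $\mathrm{P\Gamma L}(n+2,q^t)$) of the ambient space $\mathrm{PG}(n+1,q^t)$. Then $G$ is isomorphic to the setwise stabiliser $\mathrm{P\Gamma L}(n+2,q^t)_{\mathcal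 S}$ of $\mathcal S$ in $\mathrm{P\Gamma L}(n+2,q^t)$, and $$\frac{|\mathrm{Aut}(T_n^*(\mathcal S))|}{|G|}=\frac1t\,q^{\frac{t(t-1)}2}\prod_{i=1}^{t-1}(q^i-1)=\frac1t\,q^{\frac{t(t-1)}2}(q^{t-1}-1)\cdots(q^2-1)(q-1).$$ (For $t=1$ the product is empty and the ratio is $1$.) -/

import Mathlib

open scoped LinearAlgebra.Projectivization

universe u v

/-- A point-line incidence structure. -/
structure PointLineGeometry : Type (u + 1) where
  /-- the points -/
  Point : Type u
  /-- the lines -/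
  Line : Type u
  /-- incidence between a point and a line -/
  Inc : Point → Line → Prop

/-- The automorphism group of a point-line incidence structure: the pairs consisting of a
permutation of the points and a permutation of the lines that preserve incidence in both
directions. -/
def PointLineGeometry.Aut (G : PointLineGeometry.{u}) :
    Subgroup (Equiv.Perm G.Point × Equiv.Perm G.Line) where
  carrier := {x | ∀ P L, G.Inc (x.1 P) (x.2 L) ↔ G.Inc P L}
  mul_mem' := by
    intro x y hx hy P L
    exact (hx (y.1 P) (y.2 L)).trans (hy P L)
  one_mem' := fun _ _ => Iff.rfl
  inv_mem' := by
    intro x hx P L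
    have h := hx (x.1⁻¹ P) (x.2⁻¹ L)
    rw [show x.1 (x.1⁻¹ P) = P from x.1.apply_symm_apply P,
      show x.2 (x.2⁻¹ L) = L from x.2.apply_symm_apply L] at h
    exact h.symm

section Projective

variable {F : Type u} {V : Type v} [Field F] [AddCommGroup V] [Module F V]

/-- The set of points of the projective space `ℙ F V` lying in the projective subspace defined by
the linear subspace `W`. -/
def projPoints (W : Submodule F V) : Set (ℙ F V) := {P | P.submodule ≤ W}

/-- The linear representation of a set `S` of points of the hyperplane `H`. Its points are the
affine points, that is, the points of `ℙ F V` not in `H`. Its lines are the lines of `ℙ F V` (the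
linear subspaces of dimension two) that intersect `H` exactly in a point of `S`. Incidence is
natural. -/
@[reducible]
def linearRepresentation (H : Submodule F V) (S : Set (ℙ F V)) : PointLineGeometry where
  Point := {P : ℙ F V // P ∉ projPoints H}
  Line := {L : Submodule F V //
    Module.finrank F L = 2 ∧ ∃ Q ∈ S, projPoints L ∩ projPoints H = {Q}}
  Inc P L := P.1 ∈ projPoints L.1

/-- `S` is an `n`-dimensional subgeometry, over the subfield `k`, of the `n`-dimensional projective
space defined by the linear subspace `H`: the set of all points of `H` that have homogeneous
coordinates in `k`, with respect to a fixed frame (given by the vectors of a basis and their sum).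
-/
def IsSubgeometry (n : ℕ) (k : Subfield F) (H : Submodule F V) (S : Set (ℙ F V)) : Prop :=
  ∃ b : Module.Basis (Fin (n + 1)) F H,
    S = {P | ∃ (w : H) (hw : (w : V) ≠ 0),
      (∀ i, b.repr w i ∈ k) ∧ P = Projectivization.mk F (w : V) hw}

variable (F V) in
/-- The collineation group `PΓL(V)` of the projective space `ℙ F V`, as a group of permutations of
the points: the permutations that are induced by a bijective semilinear map. -/
def collineationGroup : Subgroup (Equiv.Perm (ℙ F V)) where
  carrier := {f | ∃ (σ : F ≃+* F) (g : V ≃+ V), (∀ (c : F) (v : V), g (c • v) = σ c • g v) ∧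
    ∀ (v : V) (hv : v ≠ 0),
      f (Projectivization.mk F v hv) =
        Projectivization.mk F (g v) (g.map_ne_zero_iff.mpr hv)}
  mul_mem' := by
    rintro f₁ f₂ ⟨σ₁, g₁, h₁, e₁⟩ ⟨σ₂, g₂, h₂, e₂⟩
    refine ⟨σ₂.trans σ₁, g₂.trans g₁, fun c v => ?_, fun v hv => ?_⟩
    · simp [h₁, h₂]
    · simp [Equiv.Perm.mul_apply, e₁, e₂]
  one_mem' := ⟨RingEquiv.refl F, AddEquiv.refl V, fun _ _ => rfl, fun _ _ => rfl⟩
  inv_mem' := by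
    rintro f ⟨σ, g, h, e⟩
    refine ⟨σ.symm, g.symm, fun c v => ?_, fun v hv => ?_⟩
    · apply g.injective
      simp [h]
    · rw [Equiv.Perm.inv_eq_iff_eq, e]
      simp

open scoped Pointwise in
variable (F V) in
/-- The setwise stabiliser `PΓL(V)_S` of a point set `S` in the collineation group. -/
def collineationStabilizer (S : Set (ℙ F V)) : Subgroup (Equiv.Perm (ℙ F V)) :=
  collineationGroup F V ⊓ MulAction.stabilizer (Equiv.Perm (ℙ F V)) S

/-- The automorphism `x` of the linear representation is induced by the permutation `f` of the
points of the ambient projective space: `f` extends the action of `x` on the affine points, and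
maps the point set of every line of the geometry onto the point set of its image under `x`. -/
def IsInducedBy {H : Submodule F V} {S : Set (ℙ F V)} (x : (linearRepresentation H S).Aut)
    (f : Equiv.Perm (ℙ F V)) : Prop :=
  (∀ P, f P.1 = (x.1.1 P).1) ∧ ∀ L, f '' projPoints L.1 = projPoints (x.1.2 L).1

/-- The geometric automorphism group: the automorphisms of the linear representation that are
induced by collineations of the ambient projective space. -/
def geometricAut (H : Submodule F V) (S : Set (ℙ F V)) :
    Subgroup (linearRepresentation H S).Aut where
  carrier := {x | ∃ f ∈ collineationGroup F V, IsInducedBy x f}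
  mul_mem' := by
    rintro x y ⟨f, hf, hfp, hfl⟩ ⟨g, hg, hgp, hgl⟩
    refine ⟨f * g, mul_mem hf hg, fun P => ?_, fun L => ?_⟩
    · exact (congrArg f (hgp P)).trans (hfp (y.1.1 P))
    · rw [Equiv.Perm.coe_mul, Set.image_comp, hgl]
      exact hfl (y.1.2 L)
  one_mem' := ⟨1, one_mem _, fun _ => rfl, fun L => Set.image_id _⟩
  inv_mem' := by
    rintro x ⟨f, hf, hfp, hfl⟩
    refine ⟨f⁻¹, inv_mem hf, fun P => ?_, fun L => ?_⟩
    · rw [Equiv.Perm.inv_eq_iff_eq]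
      have h := hfp (x.1.1⁻¹ P)
      rw [show x.1.1 (x.1.1⁻¹ P) = P from x.1.1.apply_symm_apply P] at h
      exact h.symm
    · have h := hfl (x.1.2⁻¹ L)
      rw [show x.1.2 (x.1.2⁻¹ L) = L from x.1.2.apply_symm_apply L] at h
      rw [← h, ← Set.image_comp, ← Equiv.Perm.coe_mul, inv_mul_cancel, Equiv.Perm.coe_one,
        Set.image_id]
      rfl

end Projective

/-! Let `F` be the field of order q^t, `k` its subfield of order q, and ι an index set of size n+1.
In coordinates with `H` at infinity, the affine points become ι → F = F ⊗ k^ι, and the lines of the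
geometry become the cosets of the subspaces F ⊗ d with d a nonzero vector over `k`; `rankOne m d` is
m ⊗ d. Every `k`-linear permutation A of `F` therefore acts as A ⊗ 1 and preserves the lines
(`exists_coordinatewise`), whereas a collineation has to be semilinear over `F`. This is the only
source of non-geometric automorphisms.

The main point is that every automorphism is an A ⊗ 1 times a geometric one. Two parallel lines in a
common plane that is spanned by two directions over `k` keep a common direction
(`image_parallel_line`); this is where q^t > 2 enters. Hence parallelograms go to parallelograms,
and an automorphism is additive up to a translation (`map_add_of_map_lines`). Following the
coordinate axes and the lines between them gives the form x ↦ ∑ α(x_i) ⊗ f_i with α semilinear over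
some automorphism σ of `k` (`exists_semilinear_of_map_lines`). Extend σ to an automorphism τ of `F`;
then A = α τ⁻¹ is `k`-linear, and removing A ⊗ 1 leaves a τ-semilinear map, which is geometric
(`exists_mul_mem_geometricAut`).

So the index of G in Aut equals the index in GL_k(F) of the subgroup of those A for which A ⊗ 1 is
geometric. These are the maps x ↦ c τ(x) with τ in Gal(F/k)
(`exists_semilinear_of_mem_geometricAut`, `card_semilinear`), (q^t − 1)t in number, and the quotient
of |GL_t(q)| by this is the stated ratio.

For the isomorphism, a collineation stabilising `S` stabilises its span `H`, hence restricts to the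
geometry, faithfully because a point at infinity is cut out by an affine line. Conversely, an
inducing collineation permutes the points at infinity of the lines, which are the points of `S`. -/

/-! ### Elementary tensors, parallelism and additivity. -/

section RankOne

variable {k M ι : Type*} [Field k] [AddCommGroup M] [Module k M]

/-- The elementary tensor of `m : M` and `d : ι → k`, as a function `ι → M`. -/
def rankOne (m : M) (d : ι → k) : ι → M := fun i => d i • m

/-- The line through `x` with direction `d`. -/
def tensorLine (x : ι → M) (d : ι → k) : Set (ι → M) := Set.range fun m => x + rankOne m d

theorem rankOne_add_left (m m' : M) (d : ι → k) :
    rankOne (m + m') d = rankOne m d + rankOne m' d := by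
  ext i; simp [rankOne]

theorem rankOne_sub_left (m m' : M) (d : ι → k) :
    rankOne (m - m') d = rankOne m d - rankOne m' d := by
  ext i; simp [rankOne, smul_sub]

theorem rankOne_neg_left (m : M) (d : ι → k) : rankOne (-m) d = -rankOne m d := by
  ext i; simp [rankOne]

@[simp] theorem rankOne_zero_left (d : ι → k) : rankOne (0 : M) d = 0 := by
  ext i; simp [rankOne]

theorem rankOne_add_right (m : M) (d d' : ι → k) :
    rankOne m (d + d') = rankOne m d + rankOne m d' := by
  ext i; simp [rankOne, add_smul]

theorem rankOne_smul (c : k) (m : M) (d : ι → k) : rankOne (c • m) d = rankOne m (c • d) := by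
  ext i; simp [rankOne, smul_smul, mul_comm]

theorem rankOne_eq_zero {m : M} {d : ι → k} (hd : d ≠ 0) (h : rankOne m d = 0) : m = 0 := by
  obtain ⟨i, hi⟩ := Function.ne_iff.mp hd
  exact (smul_eq_zero.mp (congrFun h i)).resolve_left hi

theorem mem_tensorLine_self (x : ι → M) (d : ι → k) : x ∈ tensorLine x d := ⟨0, by simp⟩

/-- Coordinate functionals on the span, extended to the whole space through a left inverse. With
`contract` they read off the components of a sum of elementary tensors. -/
theorem exists_dual_family {W : Type*} [AddCommGroup W] [Module k W] {κ : Type*} [Fintype κ]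
    [DecidableEq κ] {v : κ → W} (hv : LinearIndependent k v) :
    ∃ φ : κ → Module.Dual k W, ∀ i j, φ i (v j) = if i = j then 1 else 0 := by
  have hinj : LinearMap.ker (Fintype.linearCombination k v) = ⊥ :=
    LinearMap.ker_eq_bot.mpr hv.fintypeLinearCombination_injective
  obtain ⟨g, hg⟩ := LinearMap.exists_leftInverse_of_injective _ hinj
  refine ⟨fun i => LinearMap.proj i ∘ₗ g, fun i j => ?_⟩
  have := congrArg (fun f => f (Pi.single j 1) i) hg
  simpa [Pi.single_apply, Fintype.linearCombination_apply_single] using this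

variable [Fintype ι] [DecidableEq ι]

/-- The map `ι → M` to `M` given by a linear functional on `ι → k`. -/
def contract (φ : Module.Dual k (ι → k)) : (ι → M) →ₗ[k] M :=
  ∑ i, φ (Pi.single i 1) • LinearMap.proj i


theorem contract_rankOne (φ : Module.Dual k (ι → k)) (m : M) (d : ι → k) :
    contract φ (rankOne m d) = φ d • m := by
  have h : φ d = ∑ i, d i * φ (Pi.single i 1) := by
    conv_lhs => rw [← Finset.univ_sum_single d, map_sum]
    refine Finset.sum_congr rfl fun i _ => ?_
    rw [← smul_eq_mul, ← map_smul]
    congr 1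
    ext j
    simp [Pi.single_apply]
  rw [h, Finset.sum_smul]
  simp [contract, rankOne, smul_smul, mul_comm]

theorem eq_of_rankOne_add_eq {d e : ι → k} (h : LinearIndependent k ![d, e]) {m m' n n' : M}
    (heq : rankOne m d + rankOne n e = rankOne m' d + rankOne n' e) : m = m' ∧ n = n' := by
  obtain ⟨φ, hφ⟩ := exists_dual_family h
  have h00 := hφ 0 0
  have h01 := hφ 0 1
  have h10 := hφ 1 0
  have h11 := hφ 1 1
  simp at h00 h01 h10 h11
  have e0 := congrArg (contract (φ 0)) heq
  have e1 := congrArg (contract (φ 1)) heq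
  simp only [map_add, contract_rankOne, h00, h01, h10, h11, one_smul, zero_smul, add_zero,
    zero_add] at e0 e1
  exact ⟨e0, e1⟩

/-- If a sum of two rank one elements with independent directions has rank one, then its direction
lies in the span of the two directions. -/
theorem mem_span_of_rankOne_add {d e f : ι → k} {m n l : M} (hl : l ≠ 0)
    (h : rankOne m d + rankOne n e = rankOne l f) :
    f ∈ Submodule.span k {d, e} := by
  by_contra hf
  obtain ⟨φ, hφ, hφ'⟩ := Submodule.exists_le_ker_of_notMem hf
  have hd : φ d = 0 := hφ' (Submodule.subset_span (by simp))
  have he : φ e = 0 := hφ' (Submodule.subset_span (by simp))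
  have := congrArg (contract φ) h
  simp only [map_add, contract_rankOne, hd, he, zero_smul, add_zero] at this
  exact (smul_ne_zero hφ hl) this.symm

/-- A permutation mapping lines to lines maps coplanar parallel lines to parallel lines. -/
theorem image_parallel_line
    (hbig : (∃ μ : k, μ ≠ 0 ∧ μ ≠ 1) ∨ ∀ m : M, ∃ m₁ : M, ∀ c : k, m₁ ≠ c • m)
    (a : Equiv.Perm (ι → M))
    (ha : ∀ x (d : ι → k), d ≠ 0 → ∃ e : ι → k, e ≠ 0 ∧ a '' tensorLine x d = tensorLine (a x) e)
    {x : ι → M} {d d' e : ι → k} {m' : M} (hdd : LinearIndependent k ![d, d']) (he : e ≠ 0)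
    (hL : a '' tensorLine x d = tensorLine (a x) e) :
    a '' tensorLine (x + rankOne m' d') d = tensorLine (a (x + rankOne m' d')) e := by
  have hd : d ≠ 0 := hdd.ne_zero 0
  have hd' : d' ≠ 0 := hdd.ne_zero 1
  rcases eq_or_ne m' 0 with rfl | hm'
  · simpa using hL
  set x' := x + rankOne m' d' with hx'
  obtain ⟨e', he', hL'⟩ := ha x' d hd
  by_cases hee : LinearIndependent k ![e, e']
  swap
  · rw [LinearIndependent.pair_iff' he] at hee
    push Not at hee
    obtain ⟨c, rfl⟩ := hee
    have hc : c ≠ 0 := by rintro rfl; simp at he'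
    rw [hL']
    ext z
    constructor
    · rintro ⟨m, rfl⟩
      exact ⟨c • m, by simp only [rankOne_smul]⟩
    · rintro ⟨m, rfl⟩
      exact ⟨c⁻¹ • m, by simp only [rankOne_smul, smul_smul, inv_mul_cancel₀ hc, one_smul]⟩
  -- With independent directions the two disjoint image lines would be skew. Their common
  -- transversal, the image of the line through `x` and `x'`, is used to refute this.
  exfalso
  have hdisj : ∀ p q : M, x + rankOne p d ≠ x' + rankOne q d := by
    intro p q h
    have h1 : rankOne p d + rankOne 0 d' = rankOne q d + rankOne m' d' := by
      rw [hx', add_assoc] at h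
      simpa [add_comm] using add_left_cancel h
    exact hm' (eq_of_rankOne_add_eq hdd h1).2.symm
  have hmem : ∀ s, ∃ p, a (x + rankOne p d) = a x + rankOne s e := by
    intro s
    have : a x + rankOne s e ∈ a '' tensorLine x d := hL ▸ ⟨s, rfl⟩
    obtain ⟨_, ⟨p, rfl⟩, hp⟩ := this
    exact ⟨p, hp⟩
  have hmem' : ∀ s, ∃ p, a (x' + rankOne p d) = a x' + rankOne s e' := by
    intro s
    have : a x' + rankOne s e' ∈ a '' tensorLine x' d := hL' ▸ ⟨s, rfl⟩
    obtain ⟨_, ⟨p, rfl⟩, hp⟩ := this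
    exact ⟨p, hp⟩
  have hmap : ∀ p, ∃ s, a (x + rankOne p d) = a x + rankOne s e := by
    intro p
    have : a (x + rankOne p d) ∈ tensorLine (a x) e := hL ▸ ⟨_, ⟨p, rfl⟩, rfl⟩
    obtain ⟨s, hs⟩ := this
    exact ⟨s, hs.symm⟩
  have hmap' : ∀ p, ∃ s, a (x' + rankOne p d) = a x' + rankOne s e' := by
    intro p
    have : a (x' + rankOne p d) ∈ tensorLine (a x') e' := hL' ▸ ⟨_, ⟨p, rfl⟩, rfl⟩
    obtain ⟨s, hs⟩ := this
    exact ⟨s, hs.symm⟩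
  have hskew : ∀ s s', a x + rankOne s e ≠ a x' + rankOne s' e' := by
    intro s s' h
    obtain ⟨p, hp⟩ := hmem s
    obtain ⟨q, hq⟩ := hmem' s'
    exact hdisj p q (a.injective (hp.trans (h.trans hq.symm)))
  obtain ⟨e'', he'', hL''⟩ := ha x d' hd'
  obtain ⟨m, hm⟩ : ∃ m, a x + rankOne m e'' = a x' := by
    have : a x' ∈ tensorLine (a x) e'' := hL'' ▸ ⟨_, ⟨m', rfl⟩, rfl⟩
    exact this
  -- If e'' = αe + βe', splitting the step from `a x` to `a x'` accordingly yields a common point of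
  -- the two image lines.
  have hspan : e'' ∉ Submodule.span k {e, e'} := by
    intro h
    obtain ⟨α, β, rfl⟩ := Submodule.mem_span_pair.mp h
    apply hskew (α • m) (-(β • m))
    rw [← hm]
    simp only [rankOne_neg_left, rankOne_smul, rankOne_add_right]
    abel
  have hm0 : m ≠ 0 := by
    rintro rfl
    exact hskew 0 0 (by simpa using hm)
  rcases hbig with ⟨μ, hμ0, hμ1⟩ | hbig
  -- A third point `r` of the transversal exists. The line through it in direction d + d' meets both
  -- parallel lines, away from the transversal because μ ≠ 0, 1. Its image, of direction `e₂`,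
  -- therefore forces e and e' into the plane of `e₂` and `e''`, so that plane is the span of e and
  -- e', against `hspan`.
  · set r := x + rankOne (μ • m') d' with hr
    have hrx : r ∈ tensorLine x d' := ⟨_, rfl⟩
    obtain ⟨n, hn⟩ : ∃ n, a x + rankOne n e'' = a r := by
      have : a r ∈ tensorLine (a x) e'' := hL'' ▸ ⟨_, hrx, rfl⟩
      exact this
    have hdd' : d + d' ≠ 0 := by
      intro h
      have := (LinearIndependent.pair_iff.mp hdd 1 1 (by simpa using h)).1
      exact one_ne_zero this
    obtain ⟨e₂, -, hR⟩ := ha r (d + d') hdd'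
    have key : ∀ l, ∃ s, a (r + rankOne l (d + d')) = a r + rankOne s e₂ := by
      intro l
      have : a (r + rankOne l (d + d')) ∈ tensorLine (a r) e₂ := hR ▸ ⟨_, ⟨l, rfl⟩, rfl⟩
      obtain ⟨s, hs⟩ := this
      exact ⟨s, hs.symm⟩
    obtain ⟨l, hl⟩ := key (-(μ • m'))
    obtain ⟨l', hl'⟩ := key (m' - μ • m')
    have hz : r + rankOne (-(μ • m')) (d + d') = x + rankOne (-(μ • m')) d := by
      simp only [hr, rankOne_neg_left, rankOne_add_right]; abel
    have hz' : r + rankOne (m' - μ • m') (d + d') = x' + rankOne (m' - μ • m') d := by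
      simp only [hr, hx', rankOne_sub_left, rankOne_add_right]; abel
    rw [hz] at hl
    rw [hz'] at hl'
    obtain ⟨s, hs⟩ := hmap (-(μ • m'))
    obtain ⟨s', hs'⟩ := hmap' (m' - μ • m')
    have hs0 : s ≠ 0 := by
      rintro rfl
      have := a.injective (hs.trans (by simp : _ = a x))
      have := rankOne_eq_zero hd (by simpa using this)
      simp [hμ0, hm'] at this
    have hs0' : s' ≠ 0 := by
      rintro rfl
      have := a.injective (hs'.trans (by simp : _ = a x'))
      have := rankOne_eq_zero hd (by simpa using this)
      rw [sub_eq_zero] at this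
      have h2 : (1 - μ) • m' = 0 := by rw [sub_smul, one_smul, ← this, sub_self]
      rcases smul_eq_zero.mp h2 with h | h
      · exact hμ1 (sub_eq_zero.mp h).symm
      · exact hm' h
    have h1 : e ∈ Submodule.span k {e₂, e''} := by
      apply mem_span_of_rankOne_add (m := l) (n := n) hs0
      have := hl.symm.trans hs
      rw [← hn, add_assoc] at this
      rw [← add_left_cancel this, add_comm]
    have h1' : e' ∈ Submodule.span k {e₂, e''} := by
      apply mem_span_of_rankOne_add (m := l') (n := n - m) hs0'
      have := hl'.symm.trans hs'
      rw [← hn, ← hm, add_assoc, add_assoc] at this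
      have := add_left_cancel this
      rw [rankOne_sub_left]
      rw [← sub_eq_iff_eq_add'] at this
      rw [← this]; abel
    apply hspan
    have hle : Submodule.span k {e, e'} ≤ Submodule.span k {e₂, e''} := by
      rw [Submodule.span_le]
      rintro _ (rfl | rfl)
      exacts [h1, h1']
    have hf1 : Module.finrank k (Submodule.span k {e, e'}) = 2 := by
      have := finrank_span_eq_card hee
      rwa [Fintype.card_fin, Matrix.range_cons_cons_empty] at this
    have hf2 : Module.finrank k (Submodule.span k {e₂, e''}) ≤ 2 := by
      classical
      have := finrank_span_finset_le_card (R := k) ({e₂, e''} : Finset (ι → k))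
      simp only [Finset.coe_insert, Finset.coe_singleton] at this
      exact this.trans Finset.card_le_two
    rw [Submodule.eq_of_le_of_finrank_le hle (hf1 ▸ hf2)]
    exact Submodule.subset_span (by simp)
  -- Move to another transversal of direction d', chosen so that its image ends at `a x' + m₁ ⊗ e'`
  -- with `m₁` outside k·m. Comparing the two transversals gives m ⊗ e'' + m₁ ⊗ e' = m₂ ⊗ e + m₃ ⊗
  -- f. Modulo e the right side is a single tensor, so m and m₁ are both `k`-multiples of m₃, a
  -- contradiction.
  · obtain ⟨m₁, hm₁⟩ := hbig m
    obtain ⟨p, hp⟩ := hmem' m₁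
    obtain ⟨m₂, hm₂⟩ := hmap p
    obtain ⟨f, -, hf⟩ := ha (x + rankOne p d) d' hd'
    obtain ⟨m₃, hm₃⟩ : ∃ m₃, a (x + rankOne p d) + rankOne m₃ f = a (x' + rankOne p d) := by
      have : a (x' + rankOne p d) ∈ tensorLine (a (x + rankOne p d)) f :=
        hf ▸ ⟨_, ⟨m', rfl⟩, by congr 1; simp only [hx']; abel⟩
      exact this
    have hLI : LinearIndependent k ![e'', e, e'] := by
      have := LinearIndependent.finCons hee (x := e'')
        (by rwa [Matrix.range_cons_cons_empty])
      exact this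
    obtain ⟨φ, hφ⟩ := exists_dual_family hLI
    have heq : rankOne m e'' + rankOne m₁ e' = rankOne m₂ e + rankOne m₃ f := by
      rw [hp, hm₂, ← hm, add_assoc, add_assoc] at hm₃
      exact (add_left_cancel hm₃).symm
    have h00 := hφ 0 0
    have h01 := hφ 0 1
    have h02 := hφ 0 2
    have h20 := hφ 2 0
    have h21 := hφ 2 1
    have h22 := hφ 2 2
    simp at h00 h01 h02 h20 h21 h22
    have e0 := congrArg (contract (φ 0)) heq
    have e1 := congrArg (contract (φ 2)) heq
    simp only [map_add, contract_rankOne, h00, h01, h02, h20, h21, h22, one_smul, zero_smul,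
      add_zero, zero_add] at e0 e1
    have h0 : φ 0 f ≠ 0 := by
      intro h
      rw [h, zero_smul] at e0
      exact hm0 e0
    apply hm₁ (φ 2 f * (φ 0 f)⁻¹)
    rw [e0, e1, smul_smul, mul_assoc, inv_mul_cancel₀ h0, mul_one]

/-- Both pairs of opposite sides of a parallelogram stay parallel, so its image is again a
parallelogram and opposite sides have equal difference vectors. -/
theorem map_add_rankOne_sub
    (hbig : (∃ μ : k, μ ≠ 0 ∧ μ ≠ 1) ∨ ∀ m : M, ∃ m₁ : M, ∀ c : k, m₁ ≠ c • m)
    (a : Equiv.Perm (ι → M))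
    (ha : ∀ x (d : ι → k), d ≠ 0 → ∃ e : ι → k, e ≠ 0 ∧ a '' tensorLine x d = tensorLine (a x) e)
    (x : ι → M) {d d' : ι → k} (m m' : M) (hdd : LinearIndependent k ![d, d']) :
    a (x + rankOne m' d' + rankOne m d) - a (x + rankOne m' d') = a (x + rankOne m d) - a x := by
  have hd : d ≠ 0 := hdd.ne_zero 0
  have hd' : d' ≠ 0 := hdd.ne_zero 1
  have hdd2 : LinearIndependent k ![d', d] := LinearIndependent.pair_symm_iff.mp hdd
  rcases eq_or_ne m 0 with rfl | hm
  · simp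
  rcases eq_or_ne m' 0 with rfl | hm'
  · simp
  obtain ⟨e, he, hL⟩ := ha x d hd
  obtain ⟨e', he', hL'⟩ := ha x d' hd'
  have hP := image_parallel_line hbig a ha (m' := m') hdd he hL
  have hP' := image_parallel_line hbig a ha (m' := m) hdd2 he' hL'
  have get : ∀ {y : ι → M} {f g : ι → k} (l : M), a '' tensorLine y f = tensorLine (a y) g →
      ∃ s, a y + rankOne s g = a (y + rankOne l f) := by
    intro y f g l h
    have : a (y + rankOne l f) ∈ tensorLine (a y) g := h ▸ ⟨_, ⟨l, rfl⟩, rfl⟩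
    exact this
  obtain ⟨s, hs⟩ := get m hL
  obtain ⟨s', hs'⟩ := get m' hL'
  obtain ⟨r, hr⟩ := get m hP
  obtain ⟨r', hr'⟩ := get m' hP'
  rw [add_right_comm, ← hr', ← hs, ← hs', add_right_comm] at hr
  -- Proportional directions would put the image of `x + m' ⊗ d'` on the image of the line of
  -- direction d through `x`.
  have hee : LinearIndependent k ![e, e'] := by
    rw [LinearIndependent.pair_iff' he]
    rintro c rfl
    obtain ⟨s'', hs''⟩ : ∃ s'', a x + rankOne s'' e = a (x + rankOne m' d') :=
      ⟨c • s', by rw [rankOne_smul, hs']⟩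
    have : a (x + rankOne m' d') ∈ a '' tensorLine x d := by rw [hL]; exact ⟨_, hs''⟩
    obtain ⟨_, ⟨p, rfl⟩, hp⟩ := this
    have := add_left_cancel (a.injective hp)
    have h1 : rankOne p d + rankOne 0 d' = rankOne 0 d + rankOne m' d' := by simpa using this
    exact hm' (eq_of_rankOne_add_eq hdd h1).2.symm
  have h2 : rankOne r e + rankOne s' e' = rankOne s e + rankOne r' e' := by
    rw [add_assoc, add_assoc] at hr
    exact add_left_cancel hr
  rw [← hs, add_right_comm x, ← hr', ← hs, ← hs', ← (eq_of_rankOne_add_eq hee h2).2]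
  abel

/-- A permutation of `ι → M` mapping lines to lines is additive up to a translation. -/
theorem map_add_of_map_lines [Nontrivial ι]
    (hbig : (∃ μ : k, μ ≠ 0 ∧ μ ≠ 1) ∨ ∀ m : M, ∃ m₁ : M, ∀ c : k, m₁ ≠ c • m)
    (a : Equiv.Perm (ι → M))
    (ha : ∀ x (d : ι → k), d ≠ 0 → ∃ e : ι → k, e ≠ 0 ∧ a '' tensorLine x d = tensorLine (a x) e)
    (x y : ι → M) : a (x + y) - a x = a y - a 0 := by
  have single_ind : ∀ {i j : ι}, i ≠ j →
      LinearIndependent k ![(Pi.single i 1 : ι → k), Pi.single j 1] := by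
    intro i j hij
    rw [LinearIndependent.pair_iff]
    intro s t h
    have hi := congrFun h i
    have hj := congrFun h j
    simp [hij, hij.symm] at hi hj
    exact ⟨hi, hj⟩
  have single_ind' : ∀ {i j : ι}, i ≠ j →
      LinearIndependent k ![(Pi.single i 1 : ι → k), Pi.single i 1 + Pi.single j 1] := by
    intro i j hij
    rw [LinearIndependent.pair_iff]
    intro s t h
    have hi := congrFun h i
    have hj := congrFun h j
    simp [hij, hij.symm] at hi hj
    subst hj
    exact ⟨by simpa using hi, rfl⟩
  have rsingle : ∀ (i : ι) (m : M), Pi.single i m = rankOne m (Pi.single i 1 : ι → k) := by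
    intro i m
    ext j
    rcases eq_or_ne j i with rfl | h
    · simp [rankOne]
    · simp [rankOne, h]
  have step : ∀ (i j : ι) (m m' : M) (z : ι → M),
      a (z + Pi.single j m' + Pi.single i m) - a (z + Pi.single j m') =
        a (z + Pi.single i m) - a z := by
    intro i j m m' z
    rw [rsingle i, rsingle j]
    rcases ne_or_eq i j with hij | rfl
    · exact map_add_rankOne_sub hbig a ha z m m' (single_ind hij)
    -- Two shifts along the same axis span no parallelogram. The shift by m' ⊗ e_i is compared with
    -- the shift by m' ⊗ (e_i + e_j), which is independent of e_i; the surplus m' ⊗ e_j is then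
    -- removed.
    · obtain ⟨j, hj⟩ := exists_ne i
      have h1 := map_add_rankOne_sub hbig a ha z (d := Pi.single i 1)
        (d' := Pi.single i 1 + Pi.single j 1) m m' (single_ind' hj.symm)
      have h2 := map_add_rankOne_sub hbig a ha (z + rankOne m' (Pi.single i (1 : k))) m m'
        (single_ind hj.symm)
      rw [← h1, ← h2, rankOne_add_right, add_assoc z (rankOne m' _)]
  have step2 : ∀ (y : ι → M) (i : ι) (m : M) (z : ι → M),
      a (z + y + Pi.single i m) - a (z + y) = a (z + Pi.single i m) - a z := by
    intro y i m
    rw [← Finset.univ_sum_single y]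
    induction (Finset.univ : Finset ι) using Finset.induction_on with
    | empty => simp
    | insert j s hj ih =>
      intro z
      rw [Finset.sum_insert hj, ← add_assoc, ih, step]
  rw [← Finset.univ_sum_single y]
  suffices h : ∀ s : Finset ι, ∀ x, a (x + ∑ i ∈ s, Pi.single i (y i)) - a x =
      a (∑ i ∈ s, Pi.single i (y i)) - a 0 from h _ _
  intro s
  induction s using Finset.induction_on with
  | empty => simp
  | insert j s hj ih =>
    intro x
    rw [Finset.sum_insert hj, ← add_assoc]
    have h1 := ih (x + Pi.single j (y j))
    have h2 := ih (Pi.single j (y j))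
    have h3 := step2 x j (y j) 0
    rw [zero_add, zero_add] at h3
    rw [← sub_add_sub_cancel _ (a (x + Pi.single j (y j))), h1, h3, ← h2, sub_add_sub_cancel]

end RankOne

/-! ### Semilinear form of the additive line-preserving maps. -/

section Structure

variable {k M ι : Type*} [Field k] [AddCommGroup M] [Module k M] [Fintype ι] [DecidableEq ι]

/-- The structure of the additive permutations of `ι → M` mapping lines to lines. -/
theorem exists_semilinear_of_map_lines [Finite k] [Nontrivial M] [Nontrivial ι]
    (a : (ι → M) ≃+ (ι → M))
    (ha : ∀ d : ι → k, d ≠ 0 → ∃ e : ι → k, e ≠ 0 ∧ a '' tensorLine 0 d = tensorLine 0 e) :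
    ∃ (σ : k ≃+* k) (α : M ≃+ M) (f : ι → ι → k),
      (∀ (c : k) m, α (c • m) = σ c • α m) ∧ ∀ x, a x = ∑ i, rankOne (α (x i)) (f i) := by
  obtain ⟨m₀, hm₀⟩ := exists_ne (0 : M)
  obtain ⟨i₀, i₁, hi⟩ := exists_pair_ne ι
  have get : ∀ {d e : ι → k} (m : M), a '' tensorLine 0 d = tensorLine 0 e →
      ∃ l, a (rankOne m d) = rankOne l e := by
    intro d e m h
    have : a (rankOne m d) ∈ tensorLine 0 e := h ▸ ⟨_, ⟨m, rfl⟩, by simp⟩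
    obtain ⟨l, hl⟩ := this
    exact ⟨l, by simpa using hl.symm⟩
  have hs : ∀ i : ι, (Pi.single i 1 : ι → k) ≠ 0 := fun i => by simp
  -- The axis F ⊗ e_i goes to a line of direction `e i`, and `β i` is the map induced on the tensor
  -- factor `M`.
  choose e he0 he using fun i => ha (Pi.single i 1) (hs i)
  choose β hβ using fun i (m : M) => get m (he i)
  have rsingle : ∀ (i : ι) (m : M), Pi.single i m = rankOne m (Pi.single i 1 : ι → k) := by
    intro i m
    ext j
    rcases eq_or_ne j i with rfl | h
    · simp [rankOne]
    · simp [rankOne, h]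
  have hβ' : ∀ i m, a (Pi.single i m) = rankOne (β i m) (e i) := by
    intro i m
    rw [rsingle, hβ]
  have hβ0 : ∀ i m, m ≠ 0 → β i m ≠ 0 := by
    intro i m hm h
    have := hβ' i m
    rw [h, rankOne_zero_left, map_eq_zero_iff a a.injective] at this
    simp [hm] at this
  have hLI : ∀ i, i ≠ i₀ → LinearIndependent k ![e i₀, e i] := by
    intro i hi
    rw [LinearIndependent.pair_iff' (he0 i₀)]
    intro c hc
    have h1 := hβ' i m₀
    rw [← hc, ← rankOne_smul] at h1
    have : a (Pi.single i m₀) ∈ a '' tensorLine 0 (Pi.single i₀ (1 : k)) := by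
      rw [he, h1]
      exact ⟨_, zero_add _⟩
    obtain ⟨_, ⟨p, rfl⟩, hp⟩ := this
    have h2 := congrFun (a.injective hp) i
    simp [rankOne, hi] at h2
    exact hm₀ h2.symm
  -- The line of direction e_{i₀} + c e_i has an image with one direction `h`. The two components of
  -- β_{i₀}(m) ⊗ e_{i₀} + β_i(cm) ⊗ e_i are thus in a ratio independent of m.
  have key : ∀ i, i ≠ i₀ → ∀ c : k, ∃ s : k, ∀ m, β i (c • m) = s • β i₀ m := by
    intro i hi c
    have hd : (Pi.single i₀ 1 + Pi.single i c : ι → k) ≠ 0 := by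
      intro h
      have := congrFun h i₀
      simp [hi.symm] at this
    obtain ⟨h, -, hh⟩ := ha _ hd
    obtain ⟨φ, hφ⟩ := exists_dual_family (hLI i hi)
    have h00 := hφ 0 0
    have h01 := hφ 0 1
    have h10 := hφ 1 0
    have h11 := hφ 1 1
    simp at h00 h01 h10 h11
    have hm : ∀ m, ∃ l : M, β i₀ m = φ 0 h • l ∧ β i (c • m) = φ 1 h • l := by
      intro m
      obtain ⟨l, hl⟩ := get m hh
      have h1 : rankOne m (Pi.single i₀ 1 + Pi.single i c : ι → k) =
          Pi.single i₀ m + Pi.single i (c • m) := by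
        rw [rankOne_add_right, rsingle, rsingle i, rankOne_smul]
        congr 2
        ext j
        simp [Pi.single_apply]
      rw [h1, map_add, hβ', hβ'] at hl
      have e0 := congrArg (contract (φ 0)) hl
      have e1 := congrArg (contract (φ 1)) hl
      simp only [map_add, contract_rankOne, h00, h01, h10, h11, one_smul, zero_smul, add_zero,
        zero_add] at e0 e1
      exact ⟨l, e0, e1⟩
    have h0 : φ 0 h ≠ 0 := by
      intro h0
      obtain ⟨l, hl, -⟩ := hm m₀
      rw [h0, zero_smul] at hl
      exact hβ0 i₀ m₀ hm₀ hl
    refine ⟨φ 1 h * (φ 0 h)⁻¹, fun m => ?_⟩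
    obtain ⟨l, hl, hl'⟩ := hm m
    rw [hl, hl', smul_smul, mul_assoc, inv_mul_cancel₀ h0, mul_one]
  have hβadd : ∀ i m m', β i (m + m') = β i m + β i m' := by
    intro i m m'
    rw [← sub_eq_zero]
    apply rankOne_eq_zero (he0 i)
    rw [rankOne_sub_left, rankOne_add_left, ← hβ', ← hβ', ← hβ', Pi.single_add, map_add, sub_self]
  let α₀ : M →+ M := AddMonoidHom.mk' (β i₀) (hβadd i₀)
  have hα : Function.Bijective α₀ := by
    constructor
    · rw [injective_iff_map_eq_zero]
      intro m hm
      by_contra h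
      exact hβ0 i₀ m h hm
    · intro l
      have : rankOne l (e i₀) ∈ a '' tensorLine 0 (Pi.single i₀ (1 : k)) := by
        rw [he]
        exact ⟨l, zero_add _⟩
      obtain ⟨_, ⟨p, rfl⟩, hp⟩ := this
      refine ⟨p, ?_⟩
      rw [← sub_eq_zero]
      apply rankOne_eq_zero (he0 i₀)
      simp only [zero_add, hβ] at hp
      rw [rankOne_sub_left, ← hp, sub_eq_zero]
      rfl
  let α : M ≃+ M := AddEquiv.ofBijective α₀ hα
  have hc : ∀ i, ∃ c : k, ∀ m, β i m = c • α m := by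
    intro i
    rcases eq_or_ne i i₀ with rfl | h
    · exact ⟨1, fun m => (one_smul _ _).symm⟩
    · obtain ⟨s, hs⟩ := key i h 1
      exact ⟨s, fun m => by have := hs m; rwa [one_smul] at this⟩
  choose c hc using hc
  have hc1 : c i₁ ≠ 0 := by
    intro h
    have := hc i₁ m₀
    rw [h, zero_smul] at this
    exact hβ0 i₁ m₀ hm₀ this
  -- `key` at r, divided by its case c = 1 for the same axis `i₁`; this needs a second axis. The
  -- scalar is unique, so r ↦ s is a ring homomorphism, bijective because `k` is finite.
  have hσ : ∀ r : k, ∃ s : k, ∀ m, α (r • m) = s • α m := by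
    intro r
    obtain ⟨s, hs⟩ := key i₁ hi.symm r
    refine ⟨(c i₁)⁻¹ * s, fun m => ?_⟩
    have := hs m
    rw [hc] at this
    rw [mul_smul, eq_inv_smul_iff₀ hc1, this]
    rfl
  choose σ hσ using hσ
  have hinj : ∀ {r s : k}, r • α m₀ = s • α m₀ → r = s := by
    intro r s h
    have h0 : α m₀ ≠ 0 := by simpa using hm₀
    exact smul_left_injective k h0 h
  let σ₀ : k →+* k :=
    { toFun := σ
      map_one' := hinj (by rw [← hσ, one_smul, one_smul])
      map_mul' := fun r s => hinj (by rw [← hσ, mul_smul, hσ, hσ, smul_smul])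
      map_zero' := hinj (by rw [← hσ, zero_smul, zero_smul, map_zero])
      map_add' := fun r s => hinj (by rw [← hσ, add_smul, map_add, hσ, hσ, add_smul]) }
  refine ⟨RingEquiv.ofBijective σ₀ (Finite.injective_iff_bijective.mp σ₀.injective), α,
    fun i => c i • e i, hσ, fun x => ?_⟩
  conv_lhs => rw [← Finset.univ_sum_single x, map_sum]
  refine Finset.sum_congr rfl fun i _ => ?_
  rw [hβ', hc, rankOne_smul]

end Structure

/-! ### Finite fields and the orders of the linear groups. -/

section FiniteField

/-- An automorphism of `k` fixes the prime field, over which the finite field `F` is normal, so it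
lifts. -/
theorem exists_ringEquiv_extending {k F : Type*} [Field k] [Field F] [Finite F] [Algebra k F]
    (σ : k ≃+* k) : ∃ τ : F ≃+* F, ∀ c : k, τ (algebraMap k F c) = algebraMap k F (σ c) := by
  obtain ⟨p, hp⟩ := CharP.exists F
  have : Fact p.Prime := ⟨CharP.char_is_prime F p⟩
  have : CharP k p := (algebraMap k F).charP (algebraMap k F).injective p
  let _ : Algebra (ZMod p) F := ZMod.algebra F p
  let _ : Algebra (ZMod p) k := ZMod.algebra k p
  have : IsScalarTower (ZMod p) k F := IsScalarTower.of_algebraMap_eq' (Subsingleton.elim _ _)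
  let χ : k ≃ₐ[ZMod p] k :=
    AlgEquiv.ofRingEquiv (f := σ) (fun x => RingHom.congr_fun (Subsingleton.elim
      ((σ : k →+* k).comp (algebraMap (ZMod p) k)) (algebraMap (ZMod p) k)) x)
  exact ⟨(χ.liftNormal F).toRingEquiv, fun c => χ.liftNormal_commutes F c⟩

variable {F : Type*} [Field F] [Finite F]

variable {t q : ℕ} (k : Subfield F)

theorem Subfield.finrank_eq_of_card (hq : 1 < q) (hk : Nat.card k = q)
    (hF : Nat.card F = q ^ t) : Module.finrank k F = t := by
  have h := Module.natCard_eq_pow_finrank (K := k) (V := F)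
  rw [hF, hk] at h
  exact (Nat.pow_right_injective hq h).symm

theorem card_linearEquiv (hq : 1 < q) (hk : Nat.card k = q) (hF : Nat.card F = q ^ t) :
    Nat.card (F ≃ₗ[k] F) = ∏ i ∈ Finset.range t, (q ^ t - q ^ i) := by
  have ht := k.finrank_eq_of_card hq hk hF
  let b := Module.finBasisOfFinrankEq k F ht
  have : Fintype k := Fintype.ofFinite k
  have e : (F ≃ₗ[k] F) ≃ GL (Fin t) k :=
    (Matrix.GeneralLinearGroup.toLin' b |>.trans
      (LinearMap.GeneralLinearGroup.generalLinearEquiv k F)).symm.toEquiv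
  rw [Nat.card_congr e, Matrix.card_GL_field, ← Nat.card_eq_fintype_card, hk,
    Fin.prod_univ_eq_prod_range (fun i => q ^ t - q ^ i)]

/-- The linear maps that are semilinear over the big field. -/
theorem card_semilinear (hq : 1 < q) (hk : Nat.card k = q) (hF : Nat.card F = q ^ t) :
    Nat.card {A : F ≃ₗ[k] F // ∃ (τ : F ≃+* F) (c : F), ∀ x, A x = c * τ x} = (q ^ t - 1) * t := by
  have ht := k.finrank_eq_of_card hq hk hF
  -- The pair is unique since c = A 1, and `k`-linearity of A forces τ to fix `k`. The Galois group
  -- has order [F : k] = t.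
  let f : Fˣ × (F ≃ₐ[k] F) → {A : F ≃ₗ[k] F // ∃ (τ : F ≃+* F) (c : F), ∀ x, A x = c * τ x} :=
    fun p => ⟨p.2.toLinearEquiv.trans ((LinearEquiv.smulOfUnit p.1 : F ≃ₗ[F] F).restrictScalars k),
      p.2.toRingEquiv, p.1, fun x => rfl⟩
  have hfa : ∀ p x, (f p).1 x = p.1 * p.2 x := fun p x => rfl
  have hf : Function.Bijective f := by
    constructor
    · rintro p p' h
      have h' : ∀ x, (p.1 : F) * p.2 x = p'.1 * p'.2 x := fun x => by rw [← hfa, ← hfa, h]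
      have h1 : (p.1 : F) = p'.1 := by simpa using h' 1
      refine Prod.ext (Units.ext h1) (AlgEquiv.ext fun x => ?_)
      have h2 := h' x
      rw [h1] at h2
      exact mul_left_cancel₀ p'.1.ne_zero h2
    · rintro ⟨A, τ, c, h⟩
      have hc : c ≠ 0 := by
        rintro rfl
        have : A 1 = 0 := by simp [h]
        simp at this
      have hτ : ∀ r : k, τ (r : F) = r := by
        intro r
        apply mul_left_cancel₀ hc
        have h1 := h (r • (1 : F))
        have h2 := h 1
        rw [map_smul, h2, map_one, mul_one, Subfield.smul_def, Subfield.smul_def, smul_eq_mul,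
          smul_eq_mul, mul_one] at h1
        rw [← h1, mul_comm]
      refine ⟨(Units.mk0 c hc, AlgEquiv.ofRingEquiv (f := τ) hτ), Subtype.ext ?_⟩
      ext x
      exact (h x).symm
  rw [← Nat.card_eq_of_bijective f hf, Nat.card_prod, Nat.card_units, hF,
    IsGalois.card_aut_eq_finrank, ht]

/-- Taking q^i out of each factor leaves the factors q^j − 1 with 1 ≤ j ≤ t, in reverse order; the
one with j = t cancels. -/
theorem card_ratio (hq : 1 < q) (ht : 1 ≤ t) :
    ((∏ i ∈ Finset.range t, (q ^ t - q ^ i) : ℕ) : ℚ) / (((q ^ t - 1) * t : ℕ) : ℚ) =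
      1 / (t : ℚ) * (q : ℚ) ^ (t * (t - 1) / 2) *
        ∏ i ∈ Finset.Icc 1 (t - 1), ((q : ℚ) ^ i - 1) := by
  obtain ⟨s, rfl⟩ : ∃ s, t = s + 1 := ⟨t - 1, by omega⟩
  have hq' : (1 : ℚ) < q := by exact_mod_cast hq
  have h1 : (1 : ℚ) < (q : ℚ) ^ (s + 1) := one_lt_pow₀ hq' (by omega)
  have hn : ((q ^ (s + 1) - 1 : ℕ) : ℚ) = (q : ℚ) ^ (s + 1) - 1 := by
    rw [Nat.cast_sub (Nat.one_le_pow _ _ (by omega))]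
    push_cast
    rfl
  have hp : ((∏ i ∈ Finset.range (s + 1), (q ^ (s + 1) - q ^ i) : ℕ) : ℚ) =
      (q : ℚ) ^ ((s + 1) * (s + 1 - 1) / 2) * ∏ i ∈ Finset.range (s + 1), ((q : ℚ) ^ (i + 1) - 1) := by
    rw [← Finset.sum_range_id, ← Finset.prod_pow_eq_pow_sum,
      ← Finset.prod_range_reflect (fun i => ((q : ℚ) ^ (i + 1) - 1)), ← Finset.prod_mul_distrib,
      Nat.cast_prod]
    refine Finset.prod_congr rfl fun i hi => ?_
    have hi := Finset.mem_range.mp hi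
    rw [Nat.cast_sub (Nat.pow_le_pow_right (by omega) hi.le), mul_sub, ← pow_add]
    push_cast
    congr 2
    · omega
    · simp
  have hr : ∏ i ∈ Finset.Icc 1 s, ((q : ℚ) ^ i - 1) =
      ∏ i ∈ Finset.range s, ((q : ℚ) ^ (i + 1) - 1) := by
    rw [Finset.range_eq_Ico, Finset.prod_Ico_add' (fun i => (q : ℚ) ^ i - 1) 0 s 1]
    rfl
  rw [hp, Nat.cast_mul, hn, Finset.prod_range_succ, Nat.add_sub_cancel s 1, hr]
  have h2 : (q : ℚ) ^ (s + 1) - 1 ≠ 0 := by linarith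
  have h3 : ((s + 1 : ℕ) : ℚ) ≠ 0 := by positivity
  field_simp

end FiniteField

/-! ### Automorphisms determined by their action on points, and an index computation. -/

namespace PointLineGeometry

variable {G : PointLineGeometry.{u}}

/-- If a line is determined by its points, then an automorphism is determined by its action on the
points. -/
theorem Aut.ext_point (hG : ∀ L L', (∀ P, G.Inc P L ↔ G.Inc P L') → L = L')
    {x y : G.Aut} (h : ∀ P, x.1.1 P = y.1.1 P) : x = y := by
  refine Subtype.ext (Prod.ext (Equiv.ext h) (Equiv.ext fun L => hG _ _ fun P => ?_))
  obtain ⟨P, rfl⟩ := x.1.1.surjective P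
  rw [x.2, h, y.2]

/-- The condition on the inverse makes the induced map on lines surjective: not every line need be
an image otherwise. -/
theorem Aut.exists_of_perm (hG : ∀ L L', (∀ P, G.Inc P L ↔ G.Inc P L') → L = L')
    (p : Equiv.Perm G.Point)
    (h : ∀ L, ∃ L', ∀ P, G.Inc (p P) L' ↔ G.Inc P L)
    (h' : ∀ L, ∃ L', ∀ P, G.Inc (p⁻¹ P) L' ↔ G.Inc P L) :
    ∃ x : G.Aut, x.1.1 = p := by
  choose f hf using h
  choose f' hf' using h'
  refine ⟨⟨(p, ⟨f, f', fun L => hG _ _ fun P => ?_, fun L => hG _ _ fun P => ?_⟩),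
    fun P L => hf L P⟩, rfl⟩
  · rw [← hf L P, ← hf' (f L) (p P), show p⁻¹ (p P) = P from p.symm_apply_apply P]
  · rw [← hf' L P, ← hf (f' L) (p⁻¹ P), show p (p⁻¹ P) = P from p.apply_symm_apply P]

theorem Aut.exists_monoidHom (hG : ∀ L L', (∀ P, G.Inc P L ↔ G.Inc P L') → L = L')
    {N : Type*} [Group N] (ρ : N →* Equiv.Perm G.Point)
    (h : ∀ ν L, ∃ L', ∀ P, G.Inc (ρ ν P) L' ↔ G.Inc P L) :
    ∃ f : N →* G.Aut, ∀ ν P, (f ν).1.1 P = ρ ν P := by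
  choose f hf using fun ν => Aut.exists_of_perm hG (ρ ν) (h ν) (by simpa using h ν⁻¹)
  refine ⟨MonoidHom.mk' f fun a b => Aut.ext_point hG fun P => ?_, fun ν P => by simp [hf]⟩
  simp [hf]

end PointLineGeometry

/-- The hypothesis says that `N` acts transitively on the cosets of `G` through `f`; the stabiliser
of the trivial coset is the preimage of `G`. -/
theorem Subgroup.index_comap_of_forall_exists_mul_mem {N A : Type*} [Group N] [Group A]
    (f : N →* A) (G : Subgroup A) (h : ∀ a, ∃ ν, f ν * a ∈ G) :
    (G.comap f).index = G.index := by
  let _ : MulAction N (A ⧸ G) := MulAction.compHom (A ⧸ G) f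
  have hs : ∀ (ν : N) (a : A), ν • (a : A ⧸ G) = ((f ν * a : A) : A ⧸ G) := fun _ _ => rfl
  have h1 : ∀ x : A ⧸ G, ∃ ν : N, ν • x = ((1 : A) : A ⧸ G) := by
    intro x
    obtain ⟨a, rfl⟩ := QuotientGroup.mk_surjective x
    obtain ⟨ν, hν⟩ := h a
    refine ⟨ν, ?_⟩
    rw [hs, eq_comm, QuotientGroup.eq]
    simpa using hν
  have : MulAction.IsPretransitive N (A ⧸ G) := by
    refine ⟨fun x y => ?_⟩
    obtain ⟨ν, hν⟩ := h1 x
    obtain ⟨μ, hμ⟩ := h1 y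
    exact ⟨μ⁻¹ * ν, by rw [mul_smul, hν, ← hμ, inv_smul_smul]⟩
  have hst : G.comap f = MulAction.stabilizer N ((1 : A) : A ⧸ G) := by
    ext ν
    rw [MulAction.mem_stabilizer_iff, hs, eq_comm, QuotientGroup.eq]
    simp
  rw [hst, MulAction.index_stabilizer_of_transitive]
  rfl

/-! ### Projective lines and images of subspaces under collineations. -/

section Projective

variable {F : Type u} {V : Type v} [Field F] [AddCommGroup V] [Module F V]

theorem mk_mem_projPoints {W : Submodule F V} {v : V} (hv : v ≠ 0) :
    Projectivization.mk F v hv ∈ projPoints W ↔ v ∈ W := by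
  rw [projPoints, Set.mem_ofPred_eq, Projectivization.submodule_mk,
    Submodule.span_singleton_le_iff_mem]

theorem mem_projPoints_iff {W : Submodule F V} {P : ℙ F V} : P ∈ projPoints W ↔ P.rep ∈ W := by
  conv_lhs => rw [← P.mk_rep]
  exact mk_mem_projPoints _

/-- A projective line is determined by two of its points. -/
theorem eq_of_two_points {W W' : Submodule F V} (hW : Module.finrank F W = 2)
    (hW' : Module.finrank F W' = 2) {P Q : ℙ F V} (hPQ : P ≠ Q) (hP : P ∈ projPoints W)
    (hQ : Q ∈ projPoints W) (hP' : P ∈ projPoints W') (hQ' : Q ∈ projPoints W') : W = W' := by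
  have hLI := Projectivization.linearIndependent_pair_iff_ne.mpr hPQ
  have key : ∀ U : Submodule F V, Module.finrank F U = 2 → P ∈ projPoints U → Q ∈ projPoints U →
      Submodule.span F {P.rep, Q.rep} = U := by
    intro U hU hP hQ
    have : FiniteDimensional F U := Module.finite_of_finrank_pos (by omega)
    apply Submodule.eq_of_le_of_finrank_eq
    · rw [Submodule.span_le]
      rintro _ (rfl | rfl)
      exacts [mem_projPoints_iff.mp hP, mem_projPoints_iff.mp hQ]
    · have := finrank_span_eq_card hLI
      rw [Fintype.card_fin, Matrix.range_cons_cons_empty] at this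
      rw [this, hU]
  rw [← key W hW hP hQ, ← key W' hW' hP' hQ']

theorem exists_image_of_mem_collineationGroup {f : Equiv.Perm (ℙ F V)}
    (hf : f ∈ collineationGroup F V) (W : Submodule F V) :
    ∃ W' : Submodule F V, Module.finrank F W' = Module.finrank F W ∧
      ∀ P, f P ∈ projPoints W' ↔ P ∈ projPoints W := by
  obtain ⟨σ, g, hg, hfg⟩ := hf
  have hg' : ∀ (c : F) v, g.symm (c • v) = σ.symm c • g.symm v := by
    intro c v
    apply g.injective
    simp [hg]
  let W' : Submodule F V :=
    { carrier := {v | g.symm v ∈ W}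
      add_mem' := fun {a b} ha hb => by
        simpa using W.add_mem ha hb
      zero_mem' := by simp
      smul_mem' := fun c v hv => by
        simpa [hg'] using W.smul_mem _ hv }
  refine ⟨W', ?_, fun P => ?_⟩
  · let j : W ≃+ W' :=
      { toFun := fun w => ⟨g w, by simp [W']⟩
        invFun := fun w => ⟨g.symm w, w.2⟩
        left_inv := fun w => by simp
        right_inv := fun w => by simp
        map_add' := fun a b => by ext; simp }
    have := rank_eq_of_equiv_equiv (σ : F → F) j σ.bijective (fun r m => by ext; simp [j, hg])
    rw [Module.finrank, Module.finrank, this]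
  · induction P using Projectivization.ind with
    | h v hv =>
      rw [hfg, mk_mem_projPoints, mk_mem_projPoints]
      simp [W']

theorem exists_collineation (τ : F ≃+* F) (g : V ≃+ V)
    (hg : ∀ (c : F) (v : V), g (c • v) = τ c • g v) :
    ∃ f ∈ collineationGroup F V, ∀ (v : V) (hv : v ≠ 0),
      f (Projectivization.mk F v hv) =
        Projectivization.mk F (g v) (g.map_ne_zero_iff.mpr hv) := by
  let g' : V →ₛₗ[(τ : F →+* F)] V :=
    { toFun := g, map_add' := map_add g, map_smul' := hg }
  let f₀ : ℙ F V → ℙ F V := Projectivization.map g' g.injective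
  have hf₀ : ∀ v hv, f₀ (Projectivization.mk F v hv) =
      Projectivization.mk F (g v) (g.map_ne_zero_iff.mpr hv) := fun v hv => rfl
  have hb : Function.Bijective f₀ := by
    constructor
    · intro P Q
      induction P using Projectivization.ind with
      | h v hv =>
      induction Q using Projectivization.ind with
      | h w hw =>
        rw [hf₀, hf₀, Projectivization.mk_eq_mk_iff', Projectivization.mk_eq_mk_iff']
        rintro ⟨c, hc⟩
        refine ⟨τ.symm c, g.injective ?_⟩
        rw [hg, RingEquiv.apply_symm_apply, hc]
    · intro P
      induction P using Projectivization.ind with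
      | h v hv =>
        refine ⟨Projectivization.mk F (g.symm v) (g.symm.map_ne_zero_iff.mpr hv), ?_⟩
        rw [hf₀]
        simp
  exact ⟨Equiv.ofBijective f₀ hb, ⟨τ, g, hg, hf₀⟩, hf₀⟩

end Projective

/-! ### Affine coordinates for the linear representation. -/

section Coordinates

variable {F : Type u} {V : Type v} [Field F] [AddCommGroup V] [Module F V]

theorem rankOne_mul {k : Subfield F} {ι : Type*} (r c : F) (d : ι → k) :
    rankOne (r * c) d = r • rankOne c d := by
  ext i
  simp [rankOne, Subfield.smul_def, mul_left_comm]

/-- Coordinates adapted to a hyperplane `H` and a subgeometry `S` over `k` of it. -/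
structure SubgeometryCoordinates (k : Subfield F) (H : Submodule F V) (S : Set (ℙ F V))
    (ι : Type*) where
  /-- the coordinate map -/
  coord : V ≃ₗ[F] F × (ι → F)
  mem_hyperplane : ∀ v, v ∈ H ↔ (coord v).1 = 0
  mem_subgeometry : ∀ (v : V) (hv : v ≠ 0), Projectivization.mk F v hv ∈ S ↔
    ∃ (c : F) (d : ι → k), coord v = (0, rankOne c d)

/-- Take a functional φ with kernel `H` and a vector e with φ(e) = 1; the splitting V = F·e ⊕ H,
followed by the frame basis of `H`, is the coordinate map. -/
theorem IsSubgeometry.exists_coordinates {n : ℕ} {k : Subfield F} {H : Submodule F V}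
    {S : Set (ℙ F V)} (hS : IsSubgeometry n k H S) (hV : Module.finrank F V = n + 2)
    (hH : Module.finrank F H = n + 1) :
    Nonempty (SubgeometryCoordinates k H S (Fin (n + 1))) := by
  obtain ⟨b, rfl⟩ := hS
  have : FiniteDimensional F V := Module.finite_of_finrank_pos (by omega)
  have hq : Module.finrank F (V ⧸ H) = Module.finrank F F := by
    have := H.finrank_quotient_add_finrank
    rw [Module.finrank_self]
    omega
  let φ : V →ₗ[F] F := (LinearEquiv.ofFinrankEq (V ⧸ H) F hq).toLinearMap ∘ₗ H.mkQ
  have hφ : ∀ v, v ∈ H ↔ φ v = 0 := by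
    intro v
    simp [φ]
  have hφs : Function.Surjective φ :=
    (LinearEquiv.ofFinrankEq (V ⧸ H) F hq).surjective.comp H.mkQ_surjective
  obtain ⟨e, he⟩ := hφs 1
  let π : V →ₗ[F] H := (LinearMap.id - φ.smulRight e).codRestrict H fun v => by
    rw [hφ]; simp [he]
  have hπ : ∀ v, (π v : V) = v - φ v • e := fun v => rfl
  let Θ : V ≃ₗ[F] F × (Fin (n + 1) → F) :=
    { φ.prod (b.equivFun.toLinearMap ∘ₗ π) with
      invFun := fun p => p.1 • e + (b.equivFun.symm p.2 : H)
      left_inv := fun v => by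
        change φ v • e + (b.equivFun.symm (b.equivFun (π v)) : H) = v
        rw [LinearEquiv.symm_apply_apply, hπ, add_sub_cancel]
      right_inv := fun p => by
        have h0 : φ (b.equivFun.symm p.2 : H) = 0 := (hφ _).mp (SetLike.coe_mem _)
        have h1 : φ (p.1 • e + (b.equivFun.symm p.2 : H)) = p.1 := by
          rw [map_add, h0, map_smul, he, smul_eq_mul, mul_one, add_zero]
        refine Prod.ext h1 ?_
        change b.equivFun (π _) = p.2
        rw [← LinearEquiv.eq_symm_apply]
        ext
        rw [hπ, h1, add_sub_cancel_left] }
  have hΘ : ∀ w : H, Θ w = (0, b.equivFun w) := by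
    intro w
    have h0 : φ w = 0 := (hφ _).mp w.2
    refine Prod.ext h0 ?_
    change b.equivFun (π w) = _
    congr 1
    ext
    rw [hπ, h0, zero_smul, sub_zero]
  refine ⟨⟨Θ, hφ, fun v hv => ⟨?_, ?_⟩⟩⟩
  · rintro ⟨w, hw, hwk, h⟩
    obtain ⟨c, hc⟩ := (Projectivization.mk_eq_mk_iff' F _ _ _ _).mp h
    refine ⟨c, fun i => ⟨b.repr w i, hwk i⟩, ?_⟩
    rw [← hc, map_smul, hΘ]
    ext i
    · simp
    · simp [rankOne, Subfield.smul_def, mul_comm]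
  · rintro ⟨c, d, h⟩
    have hc : c ≠ 0 := by
      rintro rfl
      rw [rankOne_zero_left] at h
      exact hv ((LinearEquiv.map_eq_zero_iff Θ).mp h)
    let w : H := b.equivFun.symm fun i => (d i : F)
    have hw : c • (w : V) = v := by
      apply Θ.injective
      rw [h, map_smul, hΘ]
      ext i
      · simp
      · simp only [Prod.smul_snd, w, LinearEquiv.apply_symm_apply, Pi.smul_apply]
        simp [rankOne, Subfield.smul_def, mul_comm]
    have hw0 : (w : V) ≠ 0 := by
      intro h0
      rw [h0, smul_zero] at hw
      exact hv hw.symm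
    refine ⟨w, hw0, fun i => ?_, (Projectivization.mk_eq_mk_iff' F _ _ _ _).mpr ⟨c, hw⟩⟩
    have : b.repr w i = (d i : F) := by
      rw [← b.equivFun_apply]
      simp only [w, LinearEquiv.apply_symm_apply]
    rw [this]
    exact (d i).2

namespace SubgeometryCoordinates

variable {k : Subfield F} {H : Submodule F V} {S : Set (ℙ F V)} {ι : Type*}
  (C : SubgeometryCoordinates k H S ι)

/-- The vector with affine coordinates `x`. -/
def vec (x : ι → F) : V := C.coord.symm (1, x)

theorem coord_vec (x : ι → F) : C.coord (C.vec x) = (1, x) := C.coord.apply_symm_apply _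

theorem vec_ne_zero (x : ι → F) : C.vec x ≠ 0 := by
  intro h
  have := C.coord_vec x
  rw [h, map_zero] at this
  exact zero_ne_one (congrArg Prod.fst this)

theorem vec_notMem (x : ι → F) : C.vec x ∉ H := by
  rw [C.mem_hyperplane, coord_vec]
  exact one_ne_zero

/-- The affine points are in bijection with their coordinates. -/
noncomputable def point : (ι → F) ≃ {P : ℙ F V // P ∉ projPoints H} :=
  Equiv.ofBijective
    (fun x => ⟨Projectivization.mk F (C.vec x) (C.vec_ne_zero x), by
      rw [mk_mem_projPoints]; exact C.vec_notMem x⟩) <| by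
    constructor
    · intro x y h
      obtain ⟨c, hc⟩ := (Projectivization.mk_eq_mk_iff' F _ _ _ _).mp (congrArg Subtype.val h)
      have := congrArg C.coord hc
      rw [map_smul, coord_vec, coord_vec] at this
      have h1 : c = 1 := by simpa using congrArg Prod.fst this
      simpa [h1] using (congrArg Prod.snd this).symm
    · rintro ⟨P, hP⟩
      induction P using Projectivization.ind with
      | h v hv =>
        rw [mk_mem_projPoints, C.mem_hyperplane] at hP
        refine ⟨(C.coord v).1⁻¹ • (C.coord v).2, Subtype.ext ?_⟩
        refine (Projectivization.mk_eq_mk_iff' F _ _ _ _).mpr ⟨(C.coord v).1⁻¹, ?_⟩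
        apply C.coord.injective
        rw [map_smul, coord_vec]
        refine Prod.ext ?_ rfl
        simp [hP]

theorem point_coe (x : ι → F) :
    (C.point x).1 = Projectivization.mk F (C.vec x) (C.vec_ne_zero x) := rfl

theorem point_mem_iff (x : ι → F) (W : Submodule F V) :
    (C.point x).1 ∈ projPoints W ↔ C.vec x ∈ W := by
  rw [point_coe, mk_mem_projPoints]

theorem vec_add (x y : ι → F) : C.vec (x + y) = C.vec x + C.coord.symm (0, y) := by
  rw [vec, vec, ← map_add]
  simp

theorem symm_mem (x : ι → F) : C.coord.symm (0, x) ∈ H := by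
  simp [C.mem_hyperplane]

/-- A line without affine points would lie in `H` and so consist of the single point it shares with
`H`. -/
theorem exists_point_mem (L : (linearRepresentation H S).Line) :
    ∃ x, (C.point x).1 ∈ projPoints L.1 := by
  obtain ⟨L, hL, Q, hQ, hLQ⟩ := L
  by_contra! h
  have hLH : projPoints L ⊆ projPoints H := by
    intro P hP
    by_contra hPH
    apply h (C.point.symm ⟨P, hPH⟩)
    rwa [Equiv.apply_symm_apply]
  rw [Set.inter_eq_left.mpr hLH] at hLQ
  have hle : L ≤ Q.submodule := by
    intro v hv
    rcases eq_or_ne v 0 with rfl | hv0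
    · exact zero_mem _
    · have : Projectivization.mk F v hv0 ∈ projPoints L := (mk_mem_projPoints hv0).mpr hv
      rw [hLQ, Set.mem_singleton_iff] at this
      rw [← this, Projectivization.submodule_mk]
      exact Submodule.mem_span_singleton_self v
  have : FiniteDimensional F Q.submodule :=
    Module.finite_of_finrank_pos (by rw [Q.finrank_submodule]; norm_num)
  have := Submodule.finrank_mono hle
  rw [Q.finrank_submodule, hL] at this
  omega

/-- The direction is the coordinate vector over `k` of the point at infinity of the line. -/
theorem exists_direction (L : (linearRepresentation H S).Line) {x : ι → F}
    (hx : (C.point x).1 ∈ projPoints L.1) :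
    ∃ d : ι → k, d ≠ 0 ∧ ∀ y, (C.point y).1 ∈ projPoints L.1 ↔ y ∈ tensorLine x d := by
  obtain ⟨L, hL, Q, hQ, hLQ⟩ := L
  dsimp only at hx ⊢
  rw [point_mem_iff] at hx
  induction Q using Projectivization.ind with
  | h w hw =>
  obtain ⟨c, d, hd⟩ := (C.mem_subgeometry w hw).mp hQ
  have hwL : w ∈ L ∧ w ∈ H := by
    rw [← mk_mem_projPoints hw, ← mk_mem_projPoints hw (W := H), ← Set.mem_inter_iff, hLQ]
    rfl
  have hc : c ≠ 0 := by
    rintro rfl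
    rw [rankOne_zero_left] at hd
    exact hw ((LinearEquiv.map_eq_zero_iff C.coord).mp hd)
  have hd0 : d ≠ 0 := by
    rintro rfl
    have : rankOne c (0 : ι → k) = 0 := by ext i; simp [rankOne]
    rw [this] at hd
    exact hw ((LinearEquiv.map_eq_zero_iff C.coord).mp hd)
  refine ⟨d, hd0, fun y => ?_⟩
  rw [point_mem_iff]
  have hyx : C.vec y = C.vec x + C.coord.symm (0, y - x) := by
    rw [← vec_add, add_sub_cancel]
  constructor
  · intro hy
    rcases eq_or_ne y x with rfl | hne
    · exact mem_tensorLine_self _ _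
    · have hu : C.coord.symm (0, y - x) ∈ L := by
        rw [hyx] at hy
        exact (Submodule.add_mem_iff_right L hx).mp hy
      have hu0 : C.coord.symm (0, y - x) ≠ 0 := by
        intro h
        rw [LinearEquiv.map_eq_zero_iff] at h
        exact hne (sub_eq_zero.mp (congrArg Prod.snd h))
      have : Projectivization.mk F _ hu0 ∈ projPoints L ∩ projPoints H :=
        ⟨(mk_mem_projPoints _).mpr hu, (mk_mem_projPoints _).mpr (C.symm_mem _)⟩
      rw [hLQ, Set.mem_singleton_iff, Projectivization.mk_eq_mk_iff'] at this
      obtain ⟨r, hr⟩ := this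
      have := congrArg C.coord hr
      rw [map_smul, hd, LinearEquiv.apply_symm_apply] at this
      refine ⟨r * c, ?_⟩
      have h2 := congrArg Prod.snd this
      simp only [Prod.smul_snd] at h2
      dsimp only
      rw [rankOne_mul, h2, add_sub_cancel]
  · rintro ⟨m, rfl⟩
    dsimp only
    rw [vec_add]
    refine L.add_mem hx ?_
    have : C.coord.symm (0, rankOne m d) = (m * c⁻¹) • w := by
      rw [LinearEquiv.symm_apply_eq, map_smul, hd]
      ext i
      · simp
      · simp only [Prod.smul_snd]
        rw [← rankOne_mul, mul_assoc, inv_mul_cancel₀ hc, mul_one]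
    rw [this]
    exact L.smul_mem _ hwL.1

/-- The line joins the affine point to the point of `S` at infinity with coordinates 1 ⊗ d. -/
theorem exists_line (x : ι → F) {d : ι → k} (hd : d ≠ 0) :
    ∃ L : (linearRepresentation H S).Line,
      ∀ y, (C.point y).1 ∈ projPoints L.1 ↔ y ∈ tensorLine x d := by
  set w := C.coord.symm (0, rankOne (1 : F) d) with hw
  have hcw : C.coord w = (0, rankOne (1 : F) d) := by simp [hw]
  have hw0 : w ≠ 0 := by
    intro h
    rw [h, map_zero] at hcw
    exact one_ne_zero (rankOne_eq_zero hd (congrArg Prod.snd hcw).symm)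
  have hwH : w ∈ H := C.symm_mem _
  have hLI : LinearIndependent F ![C.vec x, w] := by
    rw [LinearIndependent.pair_iff]
    intro s r h
    have h1 := congrArg (fun v => (C.coord v).1) h
    simp only [map_add, map_smul, coord_vec, hcw] at h1
    have hs : s = 0 := by simpa using h1
    rw [hs, zero_smul, zero_add] at h
    exact ⟨hs, (smul_eq_zero.mp h).resolve_right hw0⟩
  have hfin : Module.finrank F (Submodule.span F {C.vec x, w}) = 2 := by
    have := finrank_span_eq_card hLI
    rwa [Fintype.card_fin, Matrix.range_cons_cons_empty] at this
  have hQ : projPoints (Submodule.span F {C.vec x, w}) ∩ projPoints H =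
      {Projectivization.mk F w hw0} := by
    ext P
    induction P using Projectivization.ind with
    | h v hv =>
    rw [Set.mem_inter_iff, mk_mem_projPoints, mk_mem_projPoints, Set.mem_singleton_iff,
      Projectivization.mk_eq_mk_iff', Submodule.mem_span_pair]
    constructor
    · rintro ⟨⟨s, r, h⟩, hvH⟩
      rw [← h, C.mem_hyperplane] at hvH
      simp only [map_add, map_smul, coord_vec, hcw] at hvH
      have hs : s = 0 := by simpa using hvH
      exact ⟨r, by rw [← h, hs, zero_smul, zero_add]⟩
    · rintro ⟨r, rfl⟩
      exact ⟨⟨0, r, by simp⟩, H.smul_mem _ hwH⟩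
  let L : (linearRepresentation H S).Line :=
    ⟨_, hfin, _, (C.mem_subgeometry w hw0).mpr ⟨1, d, hcw⟩, hQ⟩
  refine ⟨L, fun y => ?_⟩
  have hxL : (C.point x).1 ∈ projPoints L.1 := by
    rw [point_mem_iff]
    exact Submodule.subset_span (by simp)
  rw [point_mem_iff]
  change C.vec y ∈ Submodule.span F {C.vec x, w} ↔ _
  rw [Submodule.mem_span_pair]
  constructor
  · rintro ⟨s, r, h⟩
    have h1 := congrArg C.coord h
    simp only [map_add, map_smul, coord_vec, hcw] at h1
    have hs : s = 1 := by simpa using congrArg Prod.fst h1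
    have h2 := congrArg Prod.snd h1
    simp only [hs, one_smul, Prod.snd_add, Prod.smul_snd] at h2
    exact ⟨r, by rw [← h2, ← rankOne_mul, mul_one]⟩
  · rintro ⟨m, rfl⟩
    refine ⟨1, m, ?_⟩
    dsimp only
    rw [vec_add, one_smul, hw, ← map_smul]
    congr 2
    ext i
    · simp
    · simp only [Prod.smul_snd]
      rw [← rankOne_mul, mul_one]

theorem exists_ne_points (L : (linearRepresentation H S).Line) :
    ∃ x y, x ≠ y ∧ (C.point x).1 ∈ projPoints L.1 ∧ (C.point y).1 ∈ projPoints L.1 := by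
  obtain ⟨x, hx⟩ := C.exists_point_mem L
  obtain ⟨d, hd, h⟩ := C.exists_direction L hx
  refine ⟨x, x + rankOne 1 d, ?_, hx, (h _).mpr ⟨1, rfl⟩⟩
  intro h
  exact one_ne_zero (rankOne_eq_zero hd (left_eq_add.mp h))

theorem line_ext (C : SubgeometryCoordinates k H S ι) (L L' : (linearRepresentation H S).Line)
    (h : ∀ P, (linearRepresentation H S).Inc P L ↔ (linearRepresentation H S).Inc P L') :
    L = L' := by
  obtain ⟨x, y, hxy, hx, hy⟩ := C.exists_ne_points L
  apply Subtype.ext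
  refine eq_of_two_points L.2.1 L'.2.1 (P := (C.point x).1) (Q := (C.point y).1) ?_ hx hy
    ((h _).mp hx) ((h _).mp hy)
  intro he
  exact hxy (C.point.injective (Subtype.ext he))

end SubgeometryCoordinates

end Coordinates

/-! ### Geometric automorphisms and the stabiliser of the subgeometry. -/

section Geometric

variable {F : Type u} {V : Type v} [Field F] [AddCommGroup V] [Module F V]

namespace SubgeometryCoordinates

variable {k : Subfield F} {H : Submodule F V} {S : Set (ℙ F V)} {ι : Type*}

/-- `S` contains the coordinate points of `H`, so it spans `H`. -/
theorem hyperplane_le [Fintype ι] (C : SubgeometryCoordinates k H S ι) {W : Submodule F V}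
    (h : ∀ P ∈ S, P ∈ projPoints W) : H ≤ W := by
  classical
  intro v hv
  have hv' : v = ∑ i, (C.coord v).2 i • C.coord.symm (0, Pi.single i 1) := by
    apply C.coord.injective
    simp only [map_sum, map_smul, LinearEquiv.apply_symm_apply]
    rw [C.mem_hyperplane] at hv
    refine Prod.ext ?_ ?_
    · simp [hv, Prod.fst_sum]
    · ext j
      simp [Prod.snd_sum, Finset.sum_apply, Pi.single_apply]
  rw [hv']
  refine W.sum_mem fun i _ => W.smul_mem _ ?_
  have h0 : C.coord.symm (0, Pi.single i 1) ≠ 0 := by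
    rw [Ne, LinearEquiv.map_eq_zero_iff]
    intro h
    simpa using congrArg Prod.snd h
  rw [← mk_mem_projPoints h0]
  refine h _ ((C.mem_subgeometry _ h0).mpr ⟨1, Pi.single i 1, ?_⟩)
  rw [LinearEquiv.apply_symm_apply]
  refine Prod.ext rfl ?_
  ext j
  by_cases hj : j = i
  · subst hj; simp [rankOne]
  · simp [rankOne, hj]

theorem apply_mem_hyperplane [Fintype ι] [FiniteDimensional F V]
    (C : SubgeometryCoordinates k H S ι)
    {f : Equiv.Perm (ℙ F V)} (hf : f ∈ collineationStabilizer F V S) (P : ℙ F V) :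
    f P ∈ projPoints H ↔ P ∈ projPoints H := by
  obtain ⟨hf, hfS⟩ := hf
  have hfS' := MulAction.mem_stabilizer_set.mp hfS
  obtain ⟨W, hW, hfW⟩ := exists_image_of_mem_collineationGroup hf H
  have hS : ∀ P ∈ S, P ∈ projPoints H := by
    intro P
    induction P using Projectivization.ind with
    | h v hv =>
    intro hP
    obtain ⟨c, d, h⟩ := (C.mem_subgeometry v hv).mp hP
    rw [mk_mem_projPoints, C.mem_hyperplane, h]
  have hle : H ≤ W := by
    apply C.hyperplane_le
    intro P hP
    obtain ⟨Q, rfl⟩ := f.surjective P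
    rw [hfW]
    exact hS Q ((hfS' Q).mp hP)
  rw [Submodule.eq_of_le_of_finrank_eq hle hW.symm] at hfW ⊢
  exact hfW P

/-- A line has two affine points, and these already determine the image line, so agreement on affine
points suffices. -/
theorem isInducedBy_of_forall_point (C : SubgeometryCoordinates k H S ι)
    (x : (linearRepresentation H S).Aut) {f : Equiv.Perm (ℙ F V)}
    (hf : f ∈ collineationGroup F V) (h : ∀ P, f P.1 = (x.1.1 P).1) : IsInducedBy x f := by
  refine ⟨h, fun L => ?_⟩
  obtain ⟨W, hW, hfW⟩ := exists_image_of_mem_collineationGroup hf L.1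
  have h1 : f '' projPoints L.1 = projPoints W := by
    ext P
    obtain ⟨Q, rfl⟩ := f.surjective P
    rw [hfW, f.injective.mem_set_image]
  obtain ⟨y, z, hyz, hy, hz⟩ := C.exists_ne_points L
  have key : ∀ P : {P : ℙ F V // P ∉ projPoints H}, P.1 ∈ projPoints L.1 →
      f P.1 ∈ projPoints W ∧ f P.1 ∈ projPoints (x.1.2 L).1 := by
    intro P hP
    refine ⟨(hfW _).mpr hP, ?_⟩
    rw [h]
    exact (x.2 P L).mpr hP
  rw [h1, eq_of_two_points (hW.trans L.2.1) (x.1.2 L).2.1 (P := f (C.point y).1)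
    (Q := f (C.point z).1) ?_ (key _ hy).1 (key _ hz).1 (key _ hy).2 (key _ hz).2]
  intro he
  exact hyz (C.point.injective (Subtype.ext (f.injective he)))

/-- A collineation is determined by its action on the affine points, provided that it maps the
hyperplane at infinity to itself. -/
theorem eq_one_of_forall_point (C : SubgeometryCoordinates k H S ι) {f : Equiv.Perm (ℙ F V)}
    (hf : f ∈ collineationGroup F V)
    (hfH : ∀ P, f P ∈ projPoints H ↔ P ∈ projPoints H)
    (h : ∀ P, P ∉ projPoints H → f P = P) : f = 1 := by
  ext P
  rw [Equiv.Perm.one_apply]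
  by_cases hP : P ∉ projPoints H
  · exact h P hP
  rw [not_not] at hP
  induction P using Projectivization.ind with
  | h w hw =>
  have hwH := (mk_mem_projPoints hw).mp hP
  have hw1 := (C.mem_hyperplane w).mp hwH
  set x := (C.coord w).2 with hx
  have hwx : C.coord w = (0, x) := Prod.ext hw1 rfl
  have hx0 : x ≠ 0 := by
    intro h0
    rw [h0] at hwx
    exact hw ((LinearEquiv.map_eq_zero_iff C.coord).mp hwx)
  have hvx : C.vec x = C.vec 0 + w := by
    have := C.vec_add 0 x
    rwa [zero_add, ← hwx, LinearEquiv.symm_apply_apply] at this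
  have hLI : LinearIndependent F ![C.vec 0, w] := by
    rw [LinearIndependent.pair_iff]
    intro s r h
    have h1 := congrArg (fun v => (C.coord v).1) h
    simp only [map_add, map_smul, coord_vec, hwx] at h1
    have hs : s = 0 := by simpa using h1
    rw [hs, zero_smul, zero_add] at h
    exact ⟨hs, (smul_eq_zero.mp h).resolve_right hw⟩
  have hfin : Module.finrank F (Submodule.span F {C.vec 0, w}) = 2 := by
    have := finrank_span_eq_card hLI
    rwa [Fintype.card_fin, Matrix.range_cons_cons_empty] at this
  obtain ⟨W, hW, hfW⟩ := exists_image_of_mem_collineationGroup hf (Submodule.span F {C.vec 0, w})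
  have h0 : (C.point 0).1 ∈ projPoints (Submodule.span F {C.vec 0, w}) := by
    rw [point_mem_iff]
    exact Submodule.subset_span (by simp)
  have h1 : (C.point x).1 ∈ projPoints (Submodule.span F {C.vec 0, w}) := by
    rw [point_mem_iff, hvx]
    exact add_mem (Submodule.subset_span (by simp)) (Submodule.subset_span (by simp))
  have hne : (C.point 0).1 ≠ (C.point x).1 := fun he =>
    hx0 (C.point.injective (Subtype.ext he)).symm
  have hWeq : W = Submodule.span F {C.vec 0, w} := by
    refine eq_of_two_points (hW.trans hfin) hfin hne ?_ ?_ h0 h1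
    · rw [← h _ (C.point 0).2, hfW]; exact h0
    · rw [← h _ (C.point x).2, hfW]; exact h1
  -- The line joining two fixed affine points is fixed, so its point at infinity goes to a point on
  -- both this line and `H`, which is itself.
  have h2 : f (Projectivization.mk F w hw) ∈ projPoints W := by
    rw [hfW, mk_mem_projPoints]
    exact Submodule.subset_span (by simp)
  have h3 := (hfH _).mpr hP
  rw [hWeq] at h2
  generalize f (Projectivization.mk F w hw) = Q at h2 h3
  induction Q using Projectivization.ind with
  | h v hv =>
  rw [mk_mem_projPoints] at h2 h3
  obtain ⟨s, r, h⟩ := Submodule.mem_span_pair.mp h2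
  rw [← h, C.mem_hyperplane] at h3
  simp only [map_add, map_smul, coord_vec, hwx] at h3
  have hs : s = 0 := by simpa using h3
  rw [Projectivization.mk_eq_mk_iff']
  exact ⟨r, by rw [← h, hs, zero_smul, zero_add]⟩

theorem apply_mem_hyperplane_of_agree {x : (linearRepresentation H S).Aut}
    {f : Equiv.Perm (ℙ F V)} (h : ∀ P, f P.1 = (x.1.1 P).1) (P : ℙ F V) :
    f P ∈ projPoints H ↔ P ∈ projPoints H := by
  rw [← not_iff_not]
  constructor
  · intro hP
    obtain ⟨Q, hQ⟩ := x.1.1.surjective ⟨f P, hP⟩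
    have := h Q
    rw [hQ] at this
    rw [← f.injective this]
    exact Q.2
  · intro hP
    rw [h ⟨P, hP⟩]
    exact (x.1.1 ⟨P, hP⟩).2

/-- A point of `S` is the point at infinity of some line of the geometry, hence goes to the point at
infinity of the image line. -/
theorem apply_mem_of_isInducedBy (C : SubgeometryCoordinates k H S ι)
    {x : (linearRepresentation H S).Aut}
    {f : Equiv.Perm (ℙ F V)} (h : IsInducedBy x f)
    (P : ℙ F V) (hP : P ∈ S) : f P ∈ S := by
  have hH := apply_mem_hyperplane_of_agree h.1
  induction P using Projectivization.ind with
  | h w hw =>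
  obtain ⟨c, d, hcd⟩ := (C.mem_subgeometry w hw).mp hP
  have hd : d ≠ 0 := by
    rintro rfl
    have : rankOne c (0 : ι → k) = 0 := by ext i; simp [rankOne]
    rw [this] at hcd
    exact hw ((LinearEquiv.map_eq_zero_iff C.coord).mp hcd)
  obtain ⟨L, hL⟩ := C.exists_line 0 hd
  have h0 := (C.point_mem_iff _ _).mp ((hL 0).mpr (mem_tensorLine_self _ _))
  have h1 := (C.point_mem_iff _ _).mp ((hL (rankOne c d)).mpr ⟨c, by simp⟩)
  have hwL : w ∈ L.1 := by
    have := C.vec_add 0 (rankOne c d)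
    rw [zero_add, ← hcd, LinearEquiv.symm_apply_apply] at this
    rw [this] at h1
    exact (Submodule.add_mem_iff_right _ h0).mp h1
  obtain ⟨Q, hQ, hLQ⟩ := (x.1.2 L).2.2
  have : f (Projectivization.mk F w hw) ∈ projPoints (x.1.2 L).1 ∩ projPoints H := by
    refine ⟨?_, ?_⟩
    · rw [← h.2]
      exact ⟨_, (mk_mem_projPoints hw).mpr hwL, rfl⟩
    · rw [hH, mk_mem_projPoints, C.mem_hyperplane, hcd]
  rw [hLQ, Set.mem_singleton_iff] at this
  rwa [this]

open scoped Pointwise in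
/-- The geometric automorphism group is isomorphic to the stabiliser of the subgeometry. -/
theorem nonempty_geometricAut_mulEquiv [Fintype ι] [FiniteDimensional F V]
    (C : SubgeometryCoordinates k H S ι) :
    Nonempty (geometricAut H S ≃* collineationStabilizer F V S) := by
  let ρ : collineationStabilizer F V S →* Equiv.Perm (linearRepresentation H S).Point :=
    MonoidHom.mk' (fun f => f.1.subtypePerm fun P => not_congr (C.apply_mem_hyperplane f.2 P))
      fun _ _ => rfl
  have hρ : ∀ f P, (ρ f P).1 = f.1 P.1 := fun _ _ => rfl
  obtain ⟨ψ, hψ⟩ := PointLineGeometry.Aut.exists_monoidHom C.line_ext ρ <| by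
    rintro f ⟨L, hL, Q, hQ, hLQ⟩
    obtain ⟨W, hW, hfW⟩ := exists_image_of_mem_collineationGroup f.2.1 L
    refine ⟨⟨W, hW.trans hL, f.1 Q, (MulAction.mem_stabilizer_set.mp f.2.2 Q).mpr hQ, ?_⟩,
      fun P => hfW P.1⟩
    ext P
    obtain ⟨P, rfl⟩ := f.1.surjective P
    rw [Set.mem_inter_iff, hfW, C.apply_mem_hyperplane f.2, ← Set.mem_inter_iff, hLQ,
      Set.mem_singleton_iff, Set.mem_singleton_iff, f.1.apply_eq_iff_eq]
  have hψ' : ∀ f P, ((ψ f).1.1 P).1 = f.1 P.1 := fun f P => by rw [hψ, hρ]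
  have hinj : Function.Injective ψ := by
    rw [injective_iff_map_eq_one]
    intro f hf
    refine Subtype.ext (C.eq_one_of_forall_point f.2.1 (C.apply_mem_hyperplane f.2) fun P hP => ?_)
    rw [← hψ' f ⟨P, hP⟩, hf]
    rfl
  have hrange : ψ.range = geometricAut H S := by
    ext x
    constructor
    · rintro ⟨f, rfl⟩
      exact ⟨f.1, f.2.1, C.isInducedBy_of_forall_point _ f.2.1 fun P => (hψ' f P).symm⟩
    · rintro ⟨f, hf, hx⟩
      have hx' : IsInducedBy x⁻¹ f⁻¹ := by
        refine C.isInducedBy_of_forall_point _ (inv_mem hf) fun P => ?_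
        rw [Equiv.Perm.inv_eq_iff_eq, hx.1]
        exact congrArg Subtype.val (x.1.1.apply_symm_apply P).symm
      have hfS : f ∈ MulAction.stabilizer (Equiv.Perm (ℙ F V)) S := by
        refine MulAction.mem_stabilizer_set.mpr fun P => ⟨fun hP => ?_, fun hP => ?_⟩
        · have := C.apply_mem_of_isInducedBy hx' _ hP
          rwa [Equiv.Perm.smul_def, show f⁻¹ (f P) = P from f.symm_apply_apply P] at this
        · exact C.apply_mem_of_isInducedBy hx P hP
      refine ⟨⟨f, hf, hfS⟩, PointLineGeometry.Aut.ext_point C.line_ext fun P => Subtype.ext ?_⟩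
      rw [hψ', hx.1]
  exact ⟨((MonoidHom.ofInjective hinj).trans (MulEquiv.subgroupCongr hrange)).symm⟩

end SubgeometryCoordinates

end Geometric

/-! ### Factorisation of automorphisms and the index of the geometric group. -/

section Index

variable {F : Type u} {V : Type v} [Field F] [AddCommGroup V] [Module F V]

namespace SubgeometryCoordinates

variable {k : Subfield F} {H : Submodule F V} {S : Set (ℙ F V)} {ι : Type*}

/-- An automorphism that is semilinear in affine coordinates is geometric. -/
theorem mem_geometricAut (C : SubgeometryCoordinates k H S ι) (a : (linearRepresentation H S).Aut)
    (τ : F ≃+* F) (g : (ι → F) ≃+ (ι → F)) (hg : ∀ (c : F) x, g (c • x) = τ c • g x) (c : ι → F)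
    (h : ∀ x, a.1.1 (C.point x) = C.point (g x + c)) : a ∈ geometricAut H S := by
  -- The homogenisation of the affine map x ↦ g x + c.
  let g₀ : F × (ι → F) ≃+ F × (ι → F) :=
    { toFun := fun p => (τ p.1, g p.2 + τ p.1 • c)
      invFun := fun p => (τ.symm p.1, g.symm (p.2 - p.1 • c))
      left_inv := fun p => by simp
      right_inv := fun p => by simp
      map_add' := fun p p' => by
        refine Prod.ext (map_add τ _ _) ?_
        simp only [Prod.snd_add, Prod.fst_add, map_add, add_smul]
        abel }
  have hg₀ : ∀ (r : F) p, g₀ (r • p) = τ r • g₀ p := by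
    intro r p
    refine Prod.ext (map_mul τ _ _) ?_
    change g (r • p.2) + τ (r • p.1) • c = τ r • (g p.2 + τ p.1 • c)
    rw [hg, smul_eq_mul, map_mul, mul_smul, smul_add]
  obtain ⟨f, hf, hfg⟩ := exists_collineation τ
    ((C.coord.toAddEquiv.trans g₀).trans C.coord.symm.toAddEquiv)
    (fun r v => by simp [hg₀])
  refine ⟨f, hf, C.isInducedBy_of_forall_point a hf fun P => ?_⟩
  obtain ⟨x, rfl⟩ := C.point.surjective P
  rw [h, point_coe, hfg, point_coe]
  congr 1
  simp [g₀, vec]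

/-- If a map acting coordinatewise is geometric, then it is semilinear over the big field. -/
theorem exists_semilinear_of_mem_geometricAut [Nonempty ι] (C : SubgeometryCoordinates k H S ι)
    {a : (linearRepresentation H S).Aut} (ha : a ∈ geometricAut H S) (A : F ≃ₗ[k] F)
    (h : ∀ x, a.1.1 (C.point x) = C.point fun i => A (x i)) :
    ∃ (τ : F ≃+* F) (c : F), ∀ x, A x = c * τ x := by
  obtain ⟨f, hf, hx⟩ := ha
  have hfH := apply_mem_hyperplane_of_agree hx.1
  obtain ⟨τ, g, hg, hfg⟩ := hf
  obtain ⟨i⟩ := ‹Nonempty ι›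
  have hgH : ∀ v ∈ H, g v ∈ H := by
    intro v hv
    rcases eq_or_ne v 0 with rfl | hv0
    · simp
    · have := (hfH (Projectivization.mk F v hv0)).mpr ((mk_mem_projPoints hv0).mpr hv)
      rwa [hfg, mk_mem_projPoints] at this
  have key : ∀ x : ι → F, ∃ u : F, g (C.vec x) = u • C.vec fun i => A (x i) := by
    intro x
    have := hx.1 (C.point x)
    rw [h, point_coe, point_coe, hfg, Projectivization.mk_eq_mk_iff'] at this
    obtain ⟨u, hu⟩ := this
    exact ⟨u, hu.symm⟩
  obtain ⟨u, hu⟩ := key 0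
  have hvec0 : (fun i => A ((0 : ι → F) i)) = 0 := by ext; simp
  rw [hvec0] at hu
  have hu0 : u ≠ 0 := by
    rintro rfl
    rw [zero_smul] at hu
    exact (g.map_ne_zero_iff.mpr (C.vec_ne_zero 0)) hu
  -- The scalar relating `g (C.vec x)` to the image vector does not depend on x: `g` preserves `H`,
  -- so the first coordinate is always that at the origin.
  have key2 : ∀ x : ι → F, g (C.coord.symm (0, x)) = C.coord.symm (0, u • fun i => A (x i)) := by
    intro x
    obtain ⟨w, hw⟩ := key x
    have h1 := C.vec_add 0 x
    rw [zero_add] at h1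
    rw [h1, map_add, hu] at hw
    have h2 := congrArg C.coord hw
    simp only [map_add, map_smul, coord_vec] at h2
    have h3 := (C.mem_hyperplane _).mp (hgH _ (C.symm_mem x))
    have h4 : u = w := by simpa [h3] using congrArg Prod.fst h2
    rw [LinearEquiv.eq_symm_apply]
    refine Prod.ext h3 ?_
    have h5 := congrArg Prod.snd h2
    rw [← h4] at h5
    simpa using h5
  refine ⟨τ, A 1, fun r => ?_⟩
  -- Comparing with τ-semilinearity of `g` on multiples of the all-ones vector gives u·A(r) =
  -- τ(r)·u·A(1).
  have h1 := key2 (r • fun _ => 1)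
  have h2 : C.coord.symm (0, r • fun _ => 1) = r • C.coord.symm (0, fun _ : ι => (1 : F)) := by
    rw [← map_smul]
    simp
  rw [h2, hg, key2, ← map_smul] at h1
  have h3 := congrFun (congrArg Prod.snd (C.coord.symm.injective h1)) i
  simp only [Prod.smul_snd, Pi.smul_apply, smul_eq_mul, mul_one] at h3
  rw [mul_left_comm] at h3
  rw [← mul_left_cancel₀ hu0 h3, mul_comm]

theorem exists_image_tensorLine (C : SubgeometryCoordinates k H S ι)
    (a : (linearRepresentation H S).Aut) (x : ι → F) {d : ι → k} (hd : d ≠ 0) :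
    ∃ e : ι → k, e ≠ 0 ∧ C.point.symm.permCongr a.1.1 '' tensorLine x d =
      tensorLine (C.point.symm.permCongr a.1.1 x) e := by
  set p := C.point.symm.permCongr a.1.1 with hp
  have hpx : ∀ y, C.point (p y) = a.1.1 (C.point y) := by
    intro y
    simp [hp, Equiv.permCongr_apply]
  obtain ⟨L, hL⟩ := C.exists_line x hd
  have hy : ∀ y, (C.point (p y)).1 ∈ projPoints (a.1.2 L).1 ↔ y ∈ tensorLine x d := by
    intro y
    rw [← hL, hpx]
    exact a.2 (C.point y) L
  obtain ⟨e, he, hLe⟩ := C.exists_direction (a.1.2 L) ((hy x).mpr (mem_tensorLine_self _ _))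
  refine ⟨e, he, ?_⟩
  ext z
  obtain ⟨z, rfl⟩ := p.surjective z
  rw [← hLe, hy, p.injective.mem_set_image]

/-- The `k`-linear permutations of `F`, acting coordinatewise. -/
theorem exists_coordinatewise (C : SubgeometryCoordinates k H S ι) :
    ∃ ν : (F ≃ₗ[k] F) →* (linearRepresentation H S).Aut,
      ∀ A x, (ν A).1.1 (C.point x) = C.point fun i => A (x i) := by
  let ρ : (F ≃ₗ[k] F) →* Equiv.Perm (linearRepresentation H S).Point :=
    MonoidHom.mk' (fun A => C.point.permCongr (Equiv.piCongrRight fun _ => A.toEquiv))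
      fun A B => by
        ext P
        simp [Equiv.permCongr_apply]
        rfl
  have hρ : ∀ A x, ρ A (C.point x) = C.point fun i => A (x i) := by
    intro A x
    simp [ρ, Equiv.permCongr_apply]
    rfl
  obtain ⟨ν, hν⟩ := PointLineGeometry.Aut.exists_monoidHom C.line_ext ρ <| by
    intro A L
    obtain ⟨x, hx⟩ := C.exists_point_mem L
    obtain ⟨d, hd, hL⟩ := C.exists_direction L hx
    obtain ⟨L', hL'⟩ := C.exists_line (fun i => A (x i)) hd
    refine ⟨L', fun P => ?_⟩
    obtain ⟨y, rfl⟩ := C.point.surjective P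
    rw [hρ]
    change (C.point _).1 ∈ projPoints L'.1 ↔ (C.point y).1 ∈ projPoints L.1
    rw [hL', hL]
    have hA : ∀ m, (fun i => A ((x + rankOne m d) i)) = (fun i => A (x i)) + rankOne (A m) d := by
      intro m
      ext i
      simp [rankOne]
    constructor
    · rintro ⟨m, hm⟩
      refine ⟨A.symm m, ?_⟩
      have := hA (A.symm m)
      rw [A.apply_symm_apply] at this
      ext i
      exact A.injective (congrFun (this.trans hm) i)
    · rintro ⟨m, rfl⟩
      exact ⟨A m, (hA m).symm⟩
  exact ⟨ν, fun A x => by rw [hν, hρ]⟩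

/-- Every automorphism is the product of a coordinatewise linear automorphism and a geometric
automorphism. -/
theorem exists_mul_mem_geometricAut [Finite F] [Finite ι] [Nontrivial ι]
    (C : SubgeometryCoordinates k H S ι)
    (hbig : (∃ μ : k, μ ≠ 0 ∧ μ ≠ 1) ∨ ∀ m : F, ∃ m₁ : F, ∀ c : k, m₁ ≠ c • m)
    {ν : (F ≃ₗ[k] F) →* (linearRepresentation H S).Aut}
    (hν : ∀ A x, (ν A).1.1 (C.point x) = C.point fun i => A (x i))
    (a : (linearRepresentation H S).Aut) : ∃ A, ν A * a ∈ geometricAut H S := by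
  classical
  have := Fintype.ofFinite ι
  set p := C.point.symm.permCongr a.1.1 with hp
  have hpx : ∀ y, a.1.1 (C.point y) = C.point (p y) := by
    intro y
    simp [hp, Equiv.permCongr_apply]
  have hlines := fun x (d : ι → k) hd => C.exists_image_tensorLine a x (d := d) hd
  rw [← hp] at hlines
  have hadd := map_add_of_map_lines hbig p hlines
  let p₀ : (ι → F) ≃+ (ι → F) :=
    { p.trans (Equiv.subRight (p 0)) with
      map_add' := fun x y => by
        change p (x + y) - p 0 = (p x - p 0) + (p y - p 0)
        rw [← hadd x y]
        abel }
  have hp₀ : ∀ x, p₀ x = p x - p 0 := fun _ => rfl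
  obtain ⟨σ, α, f, hσ, hf⟩ := exists_semilinear_of_map_lines (k := k) p₀ <| by
    intro d hd
    obtain ⟨e, he, h⟩ := hlines 0 d hd
    refine ⟨e, he, ?_⟩
    ext z
    have h1 : z ∈ p₀ '' tensorLine 0 d ↔ z + p 0 ∈ p '' tensorLine 0 d := by
      simp only [Set.mem_image, hp₀, sub_eq_iff_eq_add]
    rw [h1, h]
    simp only [tensorLine, Set.mem_range, zero_add, add_comm z, add_right_inj]
  obtain ⟨τ, hτ⟩ := exists_ringEquiv_extending (F := F) σ
  have hτ' : ∀ c : k, τ (c : F) = σ c := hτ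
  have hτs : ∀ c : k, τ.symm (c : F) = σ.symm c := by
    intro c
    rw [RingEquiv.symm_apply_eq, hτ', RingEquiv.apply_symm_apply]
  -- A = α τ⁻¹ is `k`-linear because τ extends σ, and A⁻¹α = τ turns the semilinear form of `p₀`
  -- into x ↦ ∑ f_j τ(x_j).
  let A : F ≃ₗ[k] F :=
    { τ.symm.toAddEquiv.trans α with
      map_smul' := fun c m => by
        change α (τ.symm (c • m)) = c • α (τ.symm m)
        rw [Subfield.smul_def, smul_eq_mul, map_mul, hτs, ← smul_eq_mul, ← Subfield.smul_def, hσ,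
          RingEquiv.apply_symm_apply] }
  have hA : ∀ m, A.symm (α m) = τ m := by
    intro m
    rw [LinearEquiv.symm_apply_eq]
    change α m = α (τ.symm (τ m))
    rw [RingEquiv.symm_apply_apply]
  let g : (ι → F) ≃+ (ι → F) := p₀.trans (AddEquiv.piCongrRight fun _ => A.symm.toAddEquiv)
  have hg : ∀ x, g x = fun i => A.symm (p₀ x i) := fun _ => rfl
  have hg' : ∀ x i, g x i = ∑ j, f j i • τ (x j) := by
    intro x i
    rw [hg, hf]
    dsimp only
    rw [Finset.sum_apply, map_sum]
    refine Finset.sum_congr rfl fun j _ => ?_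
    rw [rankOne, map_smul, hA]
  refine ⟨A.symm, C.mem_geometricAut _ τ g ?_ (fun i => A.symm (p 0 i)) ?_⟩
  · intro c x
    ext i
    simp only [hg', Pi.smul_apply, smul_eq_mul, Finset.mul_sum, map_mul]
    refine Finset.sum_congr rfl fun j _ => ?_
    rw [Subfield.smul_def, Subfield.smul_def, smul_eq_mul, smul_eq_mul, mul_left_comm]
  · intro x
    have : ((ν A.symm * a).1.1 (C.point x)) = (ν A.symm).1.1 (a.1.1 (C.point x)) := rfl
    rw [this, hpx, hν]
    congr 1
    ext i
    rw [hg, Pi.add_apply, hp₀, Pi.sub_apply, map_sub, sub_add_cancel]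

theorem card_comap_geometricAut [Nonempty ι] (C : SubgeometryCoordinates k H S ι)
    {ν : (F ≃ₗ[k] F) →* (linearRepresentation H S).Aut}
    (hν : ∀ A x, (ν A).1.1 (C.point x) = C.point fun i => A (x i)) :
    Nat.card ((geometricAut H S).comap ν) =
      Nat.card {A : F ≃ₗ[k] F // ∃ (τ : F ≃+* F) (c : F), ∀ x, A x = c * τ x} := by
  refine Nat.card_congr (Equiv.subtypeEquivRight fun A => ⟨fun hA => ?_, ?_⟩)
  · exact C.exists_semilinear_of_mem_geometricAut hA A (hν A)
  · rintro ⟨τ, c, h⟩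
    refine C.mem_geometricAut _ τ (AddEquiv.piCongrRight fun _ => A.toAddEquiv) ?_ 0 ?_
    · intro r x
      ext i
      simp [h, mul_left_comm]
    · intro x
      rw [hν, add_zero]
      rfl

end SubgeometryCoordinates

/-- If t = 1 then q > 2, so `k` has a third element; if t > 1 then k·m has at most q < q^t elements.
-/
theorem exists_ne_or_forall_exists_ne_smul [Finite F] {t q : ℕ} (hqt : 2 < q ^ t) (k : Subfield F)
    (hk : Nat.card k = q) (hF : Nat.card F = q ^ t) :
    (∃ μ : k, μ ≠ 0 ∧ μ ≠ 1) ∨ ∀ m : F, ∃ m₁ : F, ∀ c : k, m₁ ≠ c • m := by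
  have hq : 1 < q := hk ▸ Finite.one_lt_card
  rcases lt_trichotomy t 1 with ht | rfl | ht
  · rw [Nat.lt_one_iff.mp ht, pow_zero] at hqt
    omega
  · left
    by_contra! h
    have hs : Function.Surjective fun b : Bool => if b then (0 : k) else 1 := by
      intro μ
      by_cases hμ : μ = 0
      · exact ⟨true, by simp [hμ]⟩
      · exact ⟨false, by simp [h μ hμ]⟩
    have := Nat.card_le_card_of_surjective _ hs
    simp only [Nat.card_eq_fintype_card, Fintype.card_bool] at this
    rw [hk] at this
    rw [pow_one] at hqt
    omega
  · right
    by_contra! h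
    obtain ⟨m, hm⟩ := h
    have hs : Function.Surjective fun c : k => c • m := fun m₁ => by
      obtain ⟨c, hc⟩ := hm m₁
      exact ⟨c, hc.symm⟩
    have := Nat.card_le_card_of_surjective _ hs
    rw [hk, hF] at this
    have h2 : q ^ 1 < q ^ t := Nat.pow_lt_pow_right hq ht
    rw [pow_one] at h2
    omega

end Index

theorem mainTheorem5 {F V : Type*} [Field F] [Finite F] [AddCommGroup V] [Module F V]
    (n t q : ℕ) (hn : 1 ≤ n) (hqt : 2 < q ^ t)
    (k : Subfield F) (hk : Nat.card k = q) (hF : Nat.card F = q ^ t)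
    (hV : Module.finrank F V = n + 2)
    (H : Submodule F V) (hH : Module.finrank F H = n + 1)
    (S : Set (ℙ F V)) (hS : IsSubgeometry n k H S) :
    Nonempty (geometricAut H S ≃* collineationStabilizer F V S) ∧
    (Nat.card (linearRepresentation H S).Aut : ℚ) / (Nat.card (geometricAut H S) : ℚ) =
      1 / (t : ℚ) * (q : ℚ) ^ (t * (t - 1) / 2) *
        ∏ i ∈ Finset.Icc 1 (t - 1), ((q : ℚ) ^ i - 1) := by
  have hq : 1 < q := hk ▸ Finite.one_lt_card
  have ht : 1 ≤ t := by
    by_contra h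
    rw [show t = 0 by omega, pow_zero] at hqt
    omega
  have : FiniteDimensional F V := Module.finite_of_finrank_pos (by omega)
  have : Finite V := Module.finite_of_finite F
  have : Finite (ℙ F V) := Quotient.finite _
  have : Nontrivial (Fin (n + 1)) := Fin.nontrivial_iff_two_le.mpr (by omega)
  obtain ⟨C⟩ := hS.exists_coordinates hV hH
  refine ⟨C.nonempty_geometricAut_mulEquiv, ?_⟩
  obtain ⟨ν, hν⟩ := C.exists_coordinatewise
  have hindex := Subgroup.index_comap_of_forall_exists_mul_mem ν (geometricAut H S)
    (C.exists_mul_mem_geometricAut (exists_ne_or_forall_exists_ne_smul hqt k hk hF) hν)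
  -- Lagrange's theorem in GL_k(F): |GL_t(q)| = (q^t − 1)t · [Aut : G].
  have hmul := ((geometricAut H S).comap ν).card_mul_index
  rw [C.card_comap_geometricAut hν, card_semilinear k hq hk hF, card_linearEquiv k hq hk hF,
    hindex] at hmul
  have hpos : Nat.card (geometricAut H S) ≠ 0 := Nat.card_pos.ne'
  rw [← card_ratio hq ht, ← hmul, ← (geometricAut H S).card_mul_index]
  have hpos' : (q ^ t - 1) * t ≠ 0 := by
    apply Nat.mul_ne_zero <;> omega
  rw [Nat.cast_mul, Nat.cast_mul, mul_div_cancel_left₀ _ (Nat.cast_ne_zero.mpr hpos),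
    mul_div_cancel_left₀ _ (Nat.cast_ne_zero.mpr hpos')]
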